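/- Let $A_0$ be a $\sigma$-unital $C^*$-algebra (i.e. $A_0$ has a countable approximate identity of positive contractions), let $K_0(A_0)=\{x\in A_0^+: xy=x \text{ for some } y\in A_0^+\}$, $K_+(A_0)=\{x\in A_0^+: x\le x_1+\dots+x_n \text{ for some } n\ge 1,\ x_k\in K_0(A_0)\}$, and let $K(A_0)=\operatorname{span}K_+(A_0)$ be the Pedersen ideal. Let $\Gamma=\Gamma(K(A_0))$ be the unital $*$-algebra of double multipliers of $K(A_0)$: pairs $(S,T)$ of linear maps $K(A_0)\to K(A_0)$ with $xS(y)=T(x)y$ for all $x,y$, with product $(S,T)(U,V)=(SU,VT)$ and involution $(S,T)^*=(T^*,S^*)$, where $S^*(x)=S(x^*)^*$. $K(A_0)$ is embedded in $\Gamma$ by $a\mapsto(b\mapsto ab,\ b\mapsto ba)$. For $a\in A_0$ let $L_a=\overline{A_0a}$, $R_a=\overline{aA_0}$, and let $M_a$ be the $C^*$-algebra of pairs of linear maps $S:L_a\to L_a$, $T:R_{a^*}\to R_{a^*}$ with $yS(x)=T(y)x$, normed by $\|(S,T)\|=\|S\|$. Give $\Gamma$ the projective topology, defined by the seminorms $(S,T)\mapsto\|S|_{L_a}\|$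 for $a\in K(A_0)$, $a\ge 0$. A unital topological $*$-algebra $A$ is a locally compact $\sigma$-$C^*$-algebra if it has a presentation $A=\varprojlim_{n\in\mathbb N}A_n$ (algebraically and topologically) by $C^*$-algebras $A_n$ with surjective morphisms $\pi_n:A\to A_n$, and a sequence $(e_n)$ in $A$ with the properties $(*)$ below. Write $\|a\|_\infty=\sup_n\|\pi_n(a)\|\in[0,\infty]$ and $A_b=\{a:\|a\|_\infty<\infty\}$, and let $A_{00}=\bigcup_n \operatorname{span}(Ae_n^2A)$ be the support algebra. $(*)$ $0\le e_n\le 1$; $Ae_n\subseteq A_b$; $e_me_n=e_n$ for $n<m$; $e_n\to1$ in the $A_{00}$-topology (the weakest topology making $a\mapsto xa$ and $a\mapsto ax$ continuous for $\|\cdot\|_\infty$, for each $x\in A_{00}$); $A$ is complete in the $A_{00}$-topology; and for all $n$ and all $a\in A$ $$\sup\{\|e_nba\|_\infty: b\in A,\ \|e_nb\|_\infty\le1\}\ \ge\ \|\pi_n(a)\|\ \ge\ \|e_na\|_\infty .$$ **Theorem.** $\Gamma(K(A_0))$ is a locally compact $\sigma$-$C^*$-algebra. More precisely, $A_0$ has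 a countable canonical approximate identity $(e_n)$ contained in $K(A_0)$, that is, one with $e_n\ge0$, $\|e_n\|\le1$ and $e_me_n=e_n$ for $n<m$; and for every such $(e_n)$: 1. $L_{e_n}\cup R_{e_n}\subseteq K(A_0)$, $L_{e_n}\subseteq L_{e_{n+1}}$ and $R_{e_n}\subseteq R_{e_{n+1}}$ for all $n$, and $\Gamma(K(A_0))=\varprojlim_n M_{e_n}$ as topological $*$-algebras, where the morphisms $\pi_n(S,T)=(S|_{L_{e_n}},T|_{R_{e_n}})$ and the connecting morphisms $M_{e_{n+1}}\to M_{e_n}$ are restrictions; 2. the images $\pi_n(\Gamma(K(A_0)))$ are $C^*$-subalgebras of the $M_{e_n}$, they give a presentation $\Gamma(K(A_0))=\varprojlim_n\pi_n(\Gamma(K(A_0)))$ with surjective morphisms, and for this presentation the sequence $(e_n)$ has the properties $(*)$; 3. the corresponding support algebra $A_{00}$ is equal to $K(A_0)$. -/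

import Mathlib

open Filter Topology
open scoped ENNReal CStarAlgebra

set_option linter.unusedSectionVars false

universe u

namespace LCPro
section Pedersen
variable (A : Type u) [NonUnitalCStarAlgebra A] [PartialOrder A] [StarOrderedRing A]

/-- `K₀(A) = {x ∈ A⁺ : x y = x for some y ∈ A⁺}`. -/
def pedersenZero : Set A := {x | 0 ≤ x ∧ ∃ y : A, 0 ≤ y ∧ x * y = x}

/-- `K₊(A)`: the positive elements dominated by a finite sum of elements of `K₀(A)`. -/
def pedersenPlus : Set A :=
  {x | 0 ≤ x ∧ ∃ n : ℕ, 1 ≤ n ∧ ∃ y : Fin n → A, (∀ k, y k ∈ pedersenZero A) ∧ x ≤ ∑ k, y k}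

/-- The Pedersen ideal `K(A)`, the linear span of `K₊(A)`. -/
def pedersenIdeal : Submodule ℂ A := Submodule.span ℂ (pedersenPlus A)

variable {A}

theorem pedersenPlus_add {x y : A} (hx : x ∈ pedersenPlus A) (hy : y ∈ pedersenPlus A) :
    x + y ∈ pedersenPlus A := by
  obtain ⟨hx0, n, hn, f, hf, hxf⟩ := hx
  obtain ⟨hy0, m, hm, g, hg, hyg⟩ := hy
  refine ⟨add_nonneg hx0 hy0, n + m, by omega, Fin.append f g, ?_, ?_⟩
  · intro k
    refine Fin.addCases (fun i => ?_) (fun i => ?_) k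
    · simpa using hf i
    · simpa using hg i
  · rw [Fin.sum_univ_add]
    simpa using add_le_add hxf hyg

theorem pedersenPlus_of_le {x y : A} (hx : 0 ≤ x) (hxy : x ≤ y) (hy : y ∈ pedersenPlus A) :
    x ∈ pedersenPlus A := by
  obtain ⟨-, n, hn, f, hf, hyf⟩ := hy
  exact ⟨hx, n, hn, f, hf, hxy.trans hyf⟩

/-- Conjugation by an element `z` of the unitization, as a map `A → A`. -/
def unitConj (z : A⁺¹) (x : A) : A := (star z * (x : A⁺¹) * z).snd

theorem inr_unitConj (z : A⁺¹) (x : A) : ((unitConj z x : A) : A⁺¹) = star z * (x : A⁺¹) * z := by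
  ext <;> simp [unitConj]

theorem inr_le {x y : A} : (x : A⁺¹) ≤ (y : A⁺¹) ↔ x ≤ y := by
  rw [← sub_nonneg, ← sub_nonneg (b := x), ← Unitization.inr_sub, Unitization.inr_nonneg_iff]

theorem unitConj_nonneg (z : A⁺¹) {x : A} (hx : 0 ≤ x) : 0 ≤ unitConj z x := by
  rw [← Unitization.inr_nonneg_iff, inr_unitConj]
  exact star_left_conjugate_nonneg (Unitization.inr_nonneg_iff.2 hx) z

theorem unitConj_mono (z : A⁺¹) {x y : A} (h : x ≤ y) : unitConj z x ≤ unitConj z y := by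
  rw [← inr_le, inr_unitConj, inr_unitConj]
  exact star_left_conjugate_le_conjugate (inr_le.2 h) z

theorem unitConj_sum (z : A⁺¹) {n : ℕ} (f : Fin n → A) :
    unitConj z (∑ k, f k) = ∑ k, unitConj z (f k) := by
  apply Unitization.inr_injective (R := ℂ)
  have key : ∀ g : Fin n → A, ((∑ k, g k : A) : A⁺¹) = ∑ k, (g k : A⁺¹) :=
    fun g => map_sum (Unitization.inrNonUnitalStarAlgHom ℂ A) g Finset.univ
  rw [key, inr_unitConj, key, Finset.mul_sum, Finset.sum_mul]
  simp only [inr_unitConj]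

theorem unitConj_mem_plus {u : A⁺¹} (hu : u ∈ unitary (A⁺¹)) {x : A} (hx : x ∈ pedersenPlus A) :
    unitConj u x ∈ pedersenPlus A := by
  obtain ⟨hx0, n, hn, f, hf, hxf⟩ := hx
  refine ⟨unitConj_nonneg u hx0, n, hn, fun k => unitConj u (f k), fun k => ?_, ?_⟩
  · obtain ⟨h0, y, hy, hxy⟩ := hf k
    refine ⟨unitConj_nonneg u h0, unitConj u y, unitConj_nonneg u hy, ?_⟩
    apply Unitization.inr_injective (R := ℂ)
    rw [Unitization.inr_mul, inr_unitConj, inr_unitConj]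
    calc star u * (f k : A⁺¹) * u * (star u * (y : A⁺¹) * u)
        = star u * (f k : A⁺¹) * (u * star u) * (y : A⁺¹) * u := by noncomm_ring
      _ = star u * ((f k : A⁺¹) * (y : A⁺¹)) * u := by
          rw [Unitary.mul_star_self_of_mem hu]; noncomm_ring
      _ = star u * (f k : A⁺¹) * u := by rw [← Unitization.inr_mul, hxy]
  · rw [← unitConj_sum]; exact unitConj_mono u hxf

theorem unitConj_one_add_mem {v : A⁺¹} (hv : v ∈ unitary (A⁺¹)) {x : A}
    (hx : x ∈ pedersenPlus A) : unitConj (1 + v) x ∈ pedersenPlus A := by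
  have h1 := unitConj_mem_plus hv hx
  refine pedersenPlus_of_le (unitConj_nonneg _ hx.1) ?_
    (pedersenPlus_add (pedersenPlus_add hx hx) (pedersenPlus_add h1 h1))
  have h2 : 0 ≤ unitConj (1 - v) x := unitConj_nonneg _ hx.1
  have h3 : x + x + (unitConj v x + unitConj v x) = unitConj (1 + v) x + unitConj (1 - v) x := by
    apply Unitization.inr_injective (R := ℂ)
    simp only [Unitization.inr_add, inr_unitConj, star_add, star_sub, star_one]
    noncomm_ring
  rw [h3]
  exact le_add_of_nonneg_right h2

theorem pedersen_unitary_mul {u : A⁺¹} (hu : u ∈ unitary (A⁺¹)) {x : A}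
    (hx : x ∈ pedersenPlus A) : (u * (x : A⁺¹)).snd ∈ pedersenIdeal A := by
  have hI : ∀ c : ℂ, star c * c = 1 → c • star u ∈ unitary (A⁺¹) := by
    intro c hc
    have h1 := Unitary.mul_star_self_of_mem hu
    have h2 := Unitary.star_mul_self_of_mem hu
    rw [Unitary.mem_iff]
    have hc' : c * star c = 1 := by rw [mul_comm]; exact hc
    constructor
    · rw [star_smul, star_star, smul_mul_smul_comm, h1, hc, one_smul]
    · rw [star_smul, star_star, smul_mul_smul_comm, h2, hc', one_smul]
  have hm : ∀ c : ℂ, star c * c = 1 → unitConj (1 + c • star u) x ∈ pedersenIdeal A :=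
    fun c hc => Submodule.subset_span (unitConj_one_add_mem (hI c hc) hx)
  have e : (u * (x : A⁺¹)).snd = (1 / 4 : ℂ) • (unitConj (1 + (1 : ℂ) • star u) x
      - unitConj (1 + (-1 : ℂ) • star u) x
      + Complex.I • unitConj (1 + Complex.I • star u) x
      - Complex.I • unitConj (1 + (-Complex.I) • star u) x) := by
    apply Unitization.inr_injective (R := ℂ)
    have : (((u * (x : A⁺¹)).snd : A) : A⁺¹) = u * (x : A⁺¹) := by ext <;> simp
    rw [this]
    simp only [Unitization.inr_add, Unitization.inr_sub, Unitization.inr_smul, inr_unitConj,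
      star_add, star_smul, star_one, star_star, mul_add, add_mul, one_mul, mul_one,
      smul_mul_assoc, mul_smul_comm, smul_smul, smul_add, smul_sub]
    simp only [RCLike.star_def, map_neg, map_one, Complex.conj_I]
    generalize (x : A⁺¹) * star u = p
    generalize u * (x : A⁺¹) = q
    generalize u * p = r
    ring_nf
    simp
    module
  rw [e]
  refine Submodule.smul_mem _ _ (Submodule.sub_mem _ (Submodule.add_mem _ (Submodule.sub_mem _
    (hm _ (by simp)) (hm _ (by simp))) (Submodule.smul_mem _ _ (hm _ (by simp))))
    (Submodule.smul_mem _ _ (hm _ (by simp))))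

theorem pedersen_unitization_mul (z : A⁺¹) {x : A} (hx : x ∈ pedersenPlus A) :
    (z * (x : A⁺¹)).snd ∈ pedersenIdeal A := by
  have hz : z ∈ Submodule.span ℂ (unitary (A⁺¹) : Set (A⁺¹)) := by
    rw [CStarAlgebra.span_unitary]; trivial
  induction hz using Submodule.span_induction with
  | mem u hu => exact pedersen_unitary_mul hu hx
  | zero => simp
  | add a b _ _ ha hb =>
    rw [add_mul, Unitization.snd_add]; exact Submodule.add_mem _ ha hb
  | smul c a _ ha =>
    rw [smul_mul_assoc, Unitization.snd_smul]; exact Submodule.smul_mem _ c ha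

theorem pedersenIdeal_mul_left (b : A) {x : A} (hx : x ∈ pedersenIdeal A) :
    b * x ∈ pedersenIdeal A := by
  induction hx using Submodule.span_induction with
  | mem x hx =>
    have := pedersen_unitization_mul (b : A⁺¹) hx
    rwa [← Unitization.inr_mul, Unitization.snd_inr] at this
  | zero => simp
  | add x y _ _ h1 h2 => rw [mul_add]; exact Submodule.add_mem _ h1 h2
  | smul c x _ h => rw [mul_smul_comm]; exact Submodule.smul_mem _ c h

theorem pedersenIdeal_star {x : A} (hx : x ∈ pedersenIdeal A) : star x ∈ pedersenIdeal A := by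
  induction hx using Submodule.span_induction with
  | mem x hx =>
    rw [(IsSelfAdjoint.of_nonneg hx.1).star_eq]; exact Submodule.subset_span hx
  | zero => simp
  | add x y _ _ h1 h2 => rw [star_add]; exact Submodule.add_mem _ h1 h2
  | smul c x _ h => rw [star_smul]; exact Submodule.smul_mem _ _ h

theorem pedersenIdeal_mul_right (b : A) {x : A} (hx : x ∈ pedersenIdeal A) :
    x * b ∈ pedersenIdeal A := by
  have := pedersenIdeal_star (pedersenIdeal_mul_left (star b) (pedersenIdeal_star hx))
  simpa using this

end Pedersen

section Multipliers
variable {A : Type u} [NonUnitalCStarAlgebra A]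

/-- The pairs `(S, T)` of linear maps `S : L → L`, `T : R → R` with `x S(y) = T(x) y` for all
`x ∈ R`, `y ∈ L`.  The second factor carries the opposite multiplication, so that
`(S, T) (U, V) = (S U, V T)`. -/
def multSubalgebra (L R : Submodule ℂ A) :
    Subalgebra ℂ (Module.End ℂ L × (Module.End ℂ R)ᵐᵒᵖ) where
  carrier := {p | ∀ (x : R) (y : L), (x : A) * (p.1 y : A) = (p.2.unop x : A) * (y : A)}
  mul_mem' {p q} hp hq x y := by
    change (x : A) * (p.1 (q.1 y) : A) = (q.2.unop (p.2.unop x) : A) * (y : A)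
    rw [hp, hq]
  add_mem' {p q} hp hq x y := by
    change (x : A) * ((p.1 y : A) + (q.1 y : A)) = ((p.2.unop x : A) + (q.2.unop x : A)) * (y : A)
    rw [mul_add, add_mul, hp, hq]
  algebraMap_mem' c x y := by
    change (x : A) * (c • (y : A)) = (c • (x : A)) * (y : A)
    rw [mul_smul_comm, smul_mul_assoc]

/-- The algebra of double multipliers of the pair `(L, R)`. -/
def Mult (L R : Submodule ℂ A) : Type u := multSubalgebra L R

noncomputable instance (L R : Submodule ℂ A) : Ring (Mult L R) :=
  inferInstanceAs (Ring (multSubalgebra L R))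
noncomputable instance (L R : Submodule ℂ A) : Algebra ℂ (Mult L R) :=
  inferInstanceAs (Algebra ℂ (multSubalgebra L R))

namespace Mult
variable {L R : Submodule ℂ A}

/-- The first component `S` of a multiplier `(S, T)`. -/
def S (m : Mult L R) : L →ₗ[ℂ] L := m.1.1
/-- The second component `T` of a multiplier `(S, T)`. -/
def T (m : Mult L R) : R →ₗ[ℂ] R := m.1.2.unop

theorem central (m : Mult L R) (x : R) (y : L) : (x : A) * (m.S y : A) = (m.T x : A) * (y : A) :=
  m.2 x y

/-- The multiplier with given components. -/
def mk (S : L →ₗ[ℂ] L) (T : R →ₗ[ℂ] R)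
    (h : ∀ (x : R) (y : L), (x : A) * (S y : A) = (T x : A) * (y : A)) : Mult L R :=
  ⟨(S, MulOpposite.op T), h⟩

@[ext] theorem ext {m n : Mult L R} (h1 : ∀ y, m.S y = n.S y) (h2 : ∀ x, m.T x = n.T x) :
    m = n := by
  apply Subtype.ext
  apply Prod.ext
  · exact LinearMap.ext h1
  · apply MulOpposite.unop_injective
    exact LinearMap.ext h2

@[simp] theorem mk_S (S : L →ₗ[ℂ] L) (T : R →ₗ[ℂ] R) (h) : (mk S T h).S = S := rfl
@[simp] theorem mk_T (S : L →ₗ[ℂ] L) (T : R →ₗ[ℂ] R) (h) : (mk S T h).T = T := rfl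
@[simp] theorem zero_S : (0 : Mult L R).S = 0 := rfl
@[simp] theorem zero_T : (0 : Mult L R).T = 0 := rfl
@[simp] theorem one_S (y : L) : (1 : Mult L R).S y = y := rfl
@[simp] theorem one_T (x : R) : (1 : Mult L R).T x = x := rfl
@[simp] theorem add_S (m n : Mult L R) : (m + n).S = m.S + n.S := rfl
@[simp] theorem add_T (m n : Mult L R) : (m + n).T = m.T + n.T := rfl
@[simp] theorem neg_S (m : Mult L R) : (-m).S = -m.S := rfl
@[simp] theorem smul_S (c : ℂ) (m : Mult L R) : (c • m).S = c • m.S := rfl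
@[simp] theorem smul_T (c : ℂ) (m : Mult L R) : (c • m).T = c • m.T := rfl
@[simp] theorem mul_S (m n : Mult L R) (y : L) : (m * n).S y = m.S (n.S y) := rfl
@[simp] theorem mul_T (m n : Mult L R) (x : R) : (m * n).T x = n.T (m.T x) := rfl

end Mult

/-- `R` is the set of adjoints of the elements of `L`. -/
class StarPair (L R : Submodule ℂ A) : Prop where
  mem_iff : ∀ x : A, star x ∈ L ↔ x ∈ R

namespace Mult
variable {L R : Submodule ℂ A} [StarPair L R]

theorem star_mem_right (y : L) : star (y : A) ∈ R := by
  rw [← StarPair.mem_iff (L := L), star_star]; exact y.2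
theorem star_mem_left (x : R) : star (x : A) ∈ L := (StarPair.mem_iff _).2 x.2

/-- For `T : R → R`, the map `T* : L → L`, `T*(y) = T(y*)*`. -/
def adjT (T : R →ₗ[ℂ] R) : L →ₗ[ℂ] L where
  toFun y := ⟨star (T ⟨star (y : A), star_mem_right y⟩ : A), star_mem_left _⟩
  map_add' y z := by
    have : (⟨star ((y + z : L) : A), star_mem_right (y + z)⟩ : R)
      = ⟨star (y : A), star_mem_right y⟩ + ⟨star (z : A), star_mem_right z⟩ := by
      ext; simp
    ext; rw [this, map_add]; simp only [Submodule.coe_add, star_add]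
  map_smul' c y := by
    have : (⟨star ((c • y : L) : A), star_mem_right (c • y)⟩ : R)
      = star c • ⟨star (y : A), star_mem_right y⟩ := by
      ext; simp
    ext; rw [this, map_smul]
    simp only [Submodule.coe_smul, star_smul, star_star, RingHom.id_apply]

/-- For `S : L → L`, the map `S* : R → R`, `S*(x) = S(x*)*`. -/
def adjS (S : L →ₗ[ℂ] L) : R →ₗ[ℂ] R where
  toFun x := ⟨star (S ⟨star (x : A), star_mem_left x⟩ : A), star_mem_right _⟩
  map_add' y z := by
    have : (⟨star ((y + z : R) : A), star_mem_left (y + z)⟩ : L)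
      = ⟨star (y : A), star_mem_left y⟩ + ⟨star (z : A), star_mem_left z⟩ := by
      ext; simp
    ext; rw [this, map_add]; simp only [Submodule.coe_add, star_add]
  map_smul' c y := by
    have : (⟨star ((c • y : R) : A), star_mem_left (c • y)⟩ : L)
      = star c • ⟨star (y : A), star_mem_left y⟩ := by
      ext; simp
    ext; rw [this, map_smul]
    simp only [Submodule.coe_smul, star_smul, star_star, RingHom.id_apply]

/-- The involution `(S, T)* = (T*, S*)`. -/
instance : Star (Mult L R) where
  star m := mk (adjT m.T) (adjS m.S) (by
    intro x y
    have h := m.central ⟨star (y : A), star_mem_right y⟩ ⟨star (x : A), star_mem_left x⟩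
    have h' := congrArg star h
    simp only [star_mul, star_star] at h'
    exact h'.symm)

theorem star_S (m : Mult L R) (y : L) :
    ((star m).S y : A) = star (m.T ⟨star (y : A), star_mem_right y⟩ : A) := rfl
theorem star_T (m : Mult L R) (x : R) :
    ((star m).T x : A) = star (m.S ⟨star (x : A), star_mem_left x⟩ : A) := rfl

instance : StarRing (Mult L R) where
  star_involutive m := by
    ext y
    · simp [star_S, star_T]
    · simp [star_S, star_T]
  star_mul m n := by
    ext y
    · simp only [mul_S, star_S, mul_T]; congr 3; ext; simp
    · simp only [mul_S, star_T, mul_T]; congr 3; ext; simp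
  star_add m n := by
    ext y
    · simp [star_S]
    · simp [star_T]

instance : StarModule ℂ (Mult L R) where
  star_smul c m := by
    ext y
    · simp [star_S]
    · simp [star_T]

end Mult

/-- `L_a = cl(A a)`. -/
noncomputable def leftHull (a : A) : Submodule ℂ A :=
  (LinearMap.range (LinearMap.mulRight ℂ a)).topologicalClosure

/-- `R_a = cl(a A)`. -/
noncomputable def rightHull (a : A) : Submodule ℂ A :=
  (LinearMap.range (LinearMap.mulLeft ℂ a)).topologicalClosure

theorem star_mem_rightHull {a x : A} (hx : x ∈ leftHull a) : star x ∈ rightHull (star a) := by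
  refine map_mem_closure continuous_star hx ?_
  rintro _ ⟨b, rfl⟩
  exact ⟨star b, by simp⟩

theorem star_mem_leftHull {a x : A} (hx : x ∈ rightHull (star a)) : star x ∈ leftHull a := by
  refine map_mem_closure continuous_star hx ?_
  rintro _ ⟨b, rfl⟩
  exact ⟨star b, by simp⟩

instance (a : A) : StarPair (leftHull a) (rightHull (star a)) where
  mem_iff x := ⟨fun h => by simpa using star_mem_rightHull h, star_mem_leftHull⟩

instance (a : A) : CompleteSpace (leftHull a) :=
  (Submodule.isClosed_topologicalClosure _).completeSpace_coe

/-- `M_a`: the pairs `(S, T)` of linear maps `S : L_a → L_a`, `T : R_{a*} → R_{a*}` with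
`y S(x) = T(y) x`. -/
abbrev HullMult (a : A) : Type u := Mult (leftHull a) (rightHull (star a))

namespace HullMult
variable {a : A}

theorem eq_zero_of_mul {z : A} (hz : z ∈ leftHull a)
    (h : ∀ y ∈ rightHull (star a), y * z = 0) : z = 0 :=
  CStarRing.star_mul_self_eq_zero_iff z |>.1 (h _ (star_mem_rightHull hz))

/-- The first component of an element of `M_a` is automatically bounded. -/
noncomputable def toCLM (m : HullMult a) : leftHull a →L[ℂ] leftHull a :=
  ContinuousLinearMap.ofSeqClosedGraph (g := m.S) (by
    intro u x y hu hy
    have hu' : Tendsto (fun n => (u n : A)) atTop (𝓝 (x : A)) :=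
      (continuous_subtype_val.tendsto x).comp hu
    have hy' : Tendsto (fun n => (m.S (u n) : A)) atTop (𝓝 (y : A)) :=
      (continuous_subtype_val.tendsto y).comp hy
    rw [← sub_eq_zero]
    apply Subtype.ext
    refine eq_zero_of_mul (a := a) (y - m.S x).2 fun r hr => ?_
    have h1 := hy'.const_mul r
    have h2 := hu'.const_mul (m.T ⟨r, hr⟩ : A)
    have h3 : ∀ n, r * (m.S (u n) : A) = (m.T ⟨r, hr⟩ : A) * (u n : A) :=
      fun n => m.central ⟨r, hr⟩ (u n)
    simp only [h3] at h1
    have h4 := tendsto_nhds_unique h1 h2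
    have h5 : r * (m.S x : A) = (m.T ⟨r, hr⟩ : A) * (x : A) := m.central ⟨r, hr⟩ x
    rw [Submodule.coe_sub, mul_sub, h4, h5, sub_self])

@[simp] theorem toCLM_apply (m : HullMult a) (x : leftHull a) : toCLM m x = m.S x := rfl

/-- The algebra homomorphism `(S, T) ↦ S` into the bounded operators on `L_a`. -/
noncomputable def toCLMHom (a : A) : HullMult a →ₐ[ℂ] (leftHull a →L[ℂ] leftHull a) where
  toFun := toCLM
  map_one' := by ext; simp
  map_mul' m n := by ext; simp
  map_zero' := by ext; simp
  map_add' m n := by ext; simp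
  commutes' c := by
    ext x
    rw [Algebra.algebraMap_eq_smul_one, Algebra.algebraMap_eq_smul_one]
    simp

theorem T_unique {m n : HullMult a} (h : ∀ x, m.S x = n.S x) : m = n := by
  refine Mult.ext h fun r => ?_
  rw [← sub_eq_zero]
  apply Subtype.ext
  have hk : ∀ y : leftHull a, ((m.T r - n.T r : rightHull (star a)) : A) * (y : A) = 0 := by
    intro y
    rw [Submodule.coe_sub, sub_mul, ← m.central, ← n.central, h, sub_self]
  have := hk ⟨_, star_mem_leftHull (m.T r - n.T r).2⟩
  exact CStarRing.mul_star_self_eq_zero_iff _ |>.1 this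

theorem toCLMHom_injective (a : A) : Function.Injective (toCLMHom a) := by
  intro m n h
  exact T_unique fun x => DFunLike.congr_fun h x

/-- The norm of `M_a` is the operator norm `‖(S, T)‖ = ‖S‖`. -/
noncomputable instance : NormedRing (HullMult a) :=
  NormedRing.induced _ _ (toCLMHom a) (toCLMHom_injective a)

noncomputable instance : NormedAlgebra ℂ (HullMult a) :=
  NormedAlgebra.induced ℂ _ _ (toCLMHom a)

theorem norm_def (m : HullMult a) : ‖m‖ = ‖toCLM m‖ := rfl

theorem norm_S_le (m : HullMult a) (x : leftHull a) : ‖(m.S x : A)‖ ≤ ‖m‖ * ‖(x : A)‖ :=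
  (toCLM m).le_opNorm x

theorem norm_T_le (m : HullMult a) (r : rightHull (star a)) :
    ‖(m.T r : A)‖ ≤ ‖m‖ * ‖(r : A)‖ := by
  set z : leftHull a := ⟨star (m.T r : A), star_mem_leftHull (m.T r).2⟩ with hz
  have h1 : (r : A) * (m.S z : A) = (m.T r : A) * star (m.T r : A) := m.central r z
  have h2 : ‖(m.T r : A)‖ * ‖(m.T r : A)‖ ≤ (‖m‖ * ‖(r : A)‖) * ‖(m.T r : A)‖ := by
    rw [← CStarRing.norm_self_mul_star, ← h1]
    calc ‖(r : A) * (m.S z : A)‖ ≤ ‖(r : A)‖ * ‖(m.S z : A)‖ := norm_mul_le _ _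
      _ ≤ ‖(r : A)‖ * (‖m‖ * ‖(z : A)‖) := by gcongr; exact norm_S_le m z
      _ = _ := by rw [hz]; simp only [norm_star]; ring
  rcases (norm_nonneg (m.T r : A)).eq_or_lt with h | h
  · rw [← h]; positivity
  · exact le_of_mul_le_mul_right h2 h

instance : CStarRing (HullMult a) where
  norm_mul_self_le m := by
    have hb : ∀ x : leftHull a, ‖toCLM m x‖ ≤ √‖star m * m‖ * ‖x‖ := by
      intro x
      have h1 : star (m.S x : A) * (m.S x : A) = star ((star m * m).S x : A) * (x : A) := by
        have h := m.central ⟨star (m.S x : A), Mult.star_mem_right (m.S x)⟩ x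
        rw [Mult.mul_S, Mult.star_S, star_star]
        exact h
      have h2 : ‖(m.S x : A)‖ * ‖(m.S x : A)‖ ≤ ‖star m * m‖ * ‖(x : A)‖ * ‖(x : A)‖ := by
        rw [← CStarRing.norm_star_mul_self, h1]
        refine (norm_mul_le _ _).trans ?_
        rw [norm_star]
        gcongr
        exact norm_S_le _ x
      rw [toCLM_apply]
      change ‖(m.S x : A)‖ ≤ √‖star m * m‖ * ‖(x : A)‖
      apply le_of_sq_le_sq _ (by positivity)
      rw [mul_pow, Real.sq_sqrt (norm_nonneg _)]
      nlinarith [h2]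
    have h3 : ‖m‖ ≤ √‖star m * m‖ :=
      (toCLM m).opNorm_le_bound (by positivity) hb
    calc ‖m‖ * ‖m‖ ≤ √‖star m * m‖ * √‖star m * m‖ := by gcongr
      _ = ‖star m * m‖ := Real.mul_self_sqrt (norm_nonneg _)

theorem isometry_toCLM : Isometry (toCLM : HullMult a → leftHull a →L[ℂ] leftHull a) :=
  Isometry.of_dist_eq fun m n => by
    rw [dist_eq_norm, dist_eq_norm, norm_def]
    exact congrArg norm ((toCLMHom a).map_sub m n).symm

instance : CompleteSpace (HullMult a) := by
  apply Metric.complete_of_cauchySeq_tendsto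
  intro u hu
  have hS : CauchySeq fun n => toCLM (u n) :=
    hu.map isometry_toCLM.uniformContinuous
  obtain ⟨F, hF⟩ := cauchySeq_tendsto_of_complete hS
  have hG : ∀ x : leftHull a, Tendsto (fun n => ((u n).S x : A)) atTop (𝓝 (F x : A)) := by
    intro x
    exact (continuous_subtype_val.tendsto _).comp
      (((ContinuousLinearMap.apply ℂ (leftHull a) x).continuous.tendsto F).comp hF)
  have hu' : CauchySeq fun n => toCLM (star (u n)) := by
    have h : CauchySeq fun n => star (u n) := by
      rw [Metric.cauchySeq_iff] at hu ⊢
      intro ε hε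
      obtain ⟨N, hN⟩ := hu ε hε
      refine ⟨N, fun m hm n hn => ?_⟩
      have := hN m hm n hn
      rw [dist_eq_norm] at this ⊢
      rwa [← star_sub, norm_star]
    exact h.map isometry_toCLM.uniformContinuous
  obtain ⟨F', hF'⟩ := cauchySeq_tendsto_of_complete hu'
  have hG' : ∀ x : leftHull a, Tendsto (fun n => ((star (u n)).S x : A)) atTop
      (𝓝 (F' x : A)) := by
    intro x
    exact (continuous_subtype_val.tendsto _).comp
      (((ContinuousLinearMap.apply ℂ (leftHull a) x).continuous.tendsto F').comp hF')
  have hT : ∀ r : rightHull (star a), Tendsto (fun n => ((u n).T r : A)) atTop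
      (𝓝 (Mult.adjS (F' : leftHull a →ₗ[ℂ] leftHull a) r : A)) := by
    intro r
    have := (hG' ⟨star (r : A), Mult.star_mem_left r⟩).star
    simp only [Mult.star_S, star_star] at this
    exact this
  let m : HullMult a := Mult.mk (F : leftHull a →ₗ[ℂ] leftHull a)
    (Mult.adjS (F' : leftHull a →ₗ[ℂ] leftHull a)) (by
      intro r x
      have h1 := (hG x).const_mul (r : A)
      have h2 := (hT r).mul_const (x : A)
      refine tendsto_nhds_unique h1 (h2.congr fun n => ?_)
      exact ((u n).central r x).symm)
  refine ⟨m, ?_⟩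
  have hm : toCLM m = F := by ext; rfl
  exact isometry_toCLM.isEmbedding.tendsto_nhds_iff.2 (by rw [hm]; exact hF)

noncomputable instance : CStarAlgebra (HullMult a) where

end HullMult

end Multipliers

/-- The uniform structure of the extended pseudometric `p (x - y)`, for a subadditive and
symmetric function `p` with values in `[0, ∞]`. -/
@[reducible] noncomputable def uniformOf {G : Type u} [AddCommGroup G] (p : G → ℝ≥0∞) (h0 : p 0 = 0)
    (hneg : ∀ x, p (-x) = p x) (hadd : ∀ x y, p (x + y) ≤ p x + p y) : UniformSpace G :=
  let _ : PseudoEMetricSpace G :=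
    { edist := fun x y => p (x - y)
      edist_self := fun x => by change p (x - x) = 0; rw [sub_self, h0]
      edist_comm := fun x y => by change p (x - y) = p (y - x); rw [← hneg, neg_sub]
      edist_triangle := fun x y z => by
        change p (x - z) ≤ p (x - y) + p (y - z)
        rw [← sub_add_sub_cancel x y z]; exact hadd _ _ }
  inferInstance

section Gamma
variable (A : Type u) [NonUnitalCStarAlgebra A] [PartialOrder A] [StarOrderedRing A]

instance : StarPair (pedersenIdeal A) (pedersenIdeal A) where
  mem_iff x := ⟨fun h => by simpa using pedersenIdeal_star h, pedersenIdeal_star⟩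

/-- `Γ(K(A))`: the unital `*`-algebra of all double multipliers `(S, T)` of the Pedersen ideal. -/
abbrev Gamma : Type u := Mult (pedersenIdeal A) (pedersenIdeal A)

variable {A}

/-- The embedding of `A` in `Γ(K(A))`, `a ↦ (S_a, T_a)` with `S_a(b) = a b`, `T_a(b) = b a`. -/
def toGamma (a : A) : Gamma A :=
  Mult.mk
    { toFun := fun b => ⟨a * (b : A), pedersenIdeal_mul_left a b.2⟩
      map_add' := fun b c => by ext; simp [mul_add]
      map_smul' := fun c b => by ext; exact mul_smul_comm c a (b : A) }
    { toFun := fun b => ⟨(b : A) * a, pedersenIdeal_mul_right a b.2⟩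
      map_add' := fun b c => by ext; simp [add_mul]
      map_smul' := fun c b => by ext; exact smul_mul_assoc c (b : A) a }
    (fun x y => (mul_assoc (x : A) a (y : A)).symm)

/-- The norm of the restriction of `(S, T) ∈ Γ(K(A))` to `L_a`, which is its norm in `M_a`; the
restriction makes sense because `L_a ⊆ K(A)` for positive `a ∈ K(A)`. -/
noncomputable def hullSeminorm (a : A) (u : Gamma A) : ℝ≥0∞ :=
  ⨆ (x : pedersenIdeal A) (_ : (x : A) ∈ leftHull a) (_ : ‖(x : A)‖ ≤ 1), ‖(u.S x : A)‖ₑ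

theorem hullSeminorm_zero (a : A) : hullSeminorm a (0 : Gamma A) = 0 := by simp [hullSeminorm]

theorem hullSeminorm_neg (a : A) (u : Gamma A) : hullSeminorm a (-u) = hullSeminorm a u := by
  simp [hullSeminorm]

theorem hullSeminorm_add (a : A) (u v : Gamma A) :
    hullSeminorm a (u + v) ≤ hullSeminorm a u + hullSeminorm a v := by
  refine iSup_le fun x => iSup_le fun h1 => iSup_le fun h2 => ?_
  rw [Mult.add_S, LinearMap.add_apply, Submodule.coe_add]
  refine (enorm_add_le _ _).trans (add_le_add ?_ ?_)
  · exact le_iSup_of_le x (le_iSup_of_le h1 (le_iSup_of_le h2 le_rfl))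
  · exact le_iSup_of_le x (le_iSup_of_le h1 (le_iSup_of_le h2 le_rfl))

/-- The projective topology of `Γ(K(A))`, induced by the norms of all the `C*`-algebras `M_a`,
`a` a positive element of `K(A)`. -/
noncomputable instance : TopologicalSpace (Gamma A) :=
  ⨅ a ∈ {a : A | a ∈ pedersenIdeal A ∧ 0 ≤ a},
    (uniformOf (hullSeminorm a) (hullSeminorm_zero a) (hullSeminorm_neg a)
      (hullSeminorm_add a)).toTopologicalSpace

variable (A) in
/-- `A` is `σ`-unital: it has a countable approximate identity of positive contractions. -/
def IsSigmaUnital : Prop :=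
  ∃ e : ℕ → A, (∀ n, 0 ≤ e n) ∧ (∀ n, ‖e n‖ ≤ 1) ∧
    ∀ a : A, Tendsto (fun n => e n * a) atTop (𝓝 a) ∧ Tendsto (fun n => a * e n) atTop (𝓝 a)

/-- `(e_n)` is a (countable, contractive, positive) canonical approximate identity of `A`. -/
structure IsCanonicalApproxId (e : ℕ → A) : Prop where
  nonneg : ∀ n, 0 ≤ e n
  norm_le_one : ∀ n, ‖e n‖ ≤ 1
  canonical : ∀ n m, n < m → e m * e n = e n
  tendsto_left : ∀ a : A, Tendsto (fun n => e n * a) atTop (𝓝 a)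
  tendsto_right : ∀ a : A, Tendsto (fun n => a * e n) atTop (𝓝 a)

end Gamma

section LocallyCompact
universe v
variable {B : Type u} [Ring B] [StarRing B] [Algebra ℂ B]

/-- A presentation of the topological `*`-algebra `B` as the inverse limit of a sequence of
`C*`-algebras `X n` along connecting `*`-homomorphisms `X (n + 1) → X n`: the canonical map from
`B` to the set of compatible sequences is bijective, and `B` has the projective topology. -/
structure InvLimit (B : Type u) [Ring B] [StarRing B] [Algebra ℂ B] [TopologicalSpace B]
    (X : ℕ → Type v) [∀ n, CStarAlgebra (X n)] where
  conn : ∀ n, X (n + 1) →⋆ₐ[ℂ] X n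
  π : ∀ n, B →⋆ₐ[ℂ] X n
  conn_π : ∀ n b, conn n (π (n + 1) b) = π n b
  existsUnique : ∀ x : ∀ n, X n, (∀ n, conn n (x (n + 1)) = x n) → ∃! b, ∀ n, π n b = x n
  topology_eq : (inferInstance : TopologicalSpace B) =
    ⨅ n, TopologicalSpace.induced (π n) inferInstance

/-- Positive elements of a pro-`C*`-algebra. -/
def IsPos (b : B) : Prop := ∃ y : B, b = star y * y

/-- The support algebra `⋃ₙ B eₙ² B`, where `B x B` is the span of the products `b x c`. -/
def supportAlgebra (e : ℕ → B) : Set B :=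
  ⋃ n, (Submodule.span ℂ {z : B | ∃ b c : B, z = b * e n ^ 2 * c} : Set B)

namespace InvLimit
variable [TopologicalSpace B] {X : ℕ → Type v} [∀ n, CStarAlgebra (X n)] (P : InvLimit B X)

/-- `‖b‖_∞ = supₙ ‖πₙ(b)‖`, with values in `[0, ∞]`. -/
noncomputable def supNorm (b : B) : ℝ≥0∞ := ⨆ n, ‖P.π n b‖ₑ

/-- The algebra `B_b` of bounded elements. -/
def bounded : Set B := {b | P.supNorm b < ⊤}

theorem supNorm_zero : P.supNorm 0 = 0 := by simp [supNorm]

theorem supNorm_neg (b : B) : P.supNorm (-b) = P.supNorm b := by simp [supNorm]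

theorem supNorm_add (b c : B) : P.supNorm (b + c) ≤ P.supNorm b + P.supNorm c := by
  refine iSup_le fun n => ?_
  rw [map_add]
  exact (enorm_add_le _ _).trans
    (add_le_add (le_iSup (fun n => ‖P.π n b‖ₑ) n) (le_iSup (fun n => ‖P.π n c‖ₑ) n))

/-- The uniform structure of `‖b - c‖_∞`; on `B_b` it is the one of the norm. -/
@[reducible] noncomputable def supUniform : UniformSpace B :=
  uniformOf P.supNorm P.supNorm_zero P.supNorm_neg P.supNorm_add

/-- The uniform structure of the `J`-topology: the weakest one for which all the maps `b ↦ x b`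
and `b ↦ b x`, `x ∈ J`, are uniformly continuous for `‖ ‖_∞`. -/
@[reducible] noncomputable def idealUniform (J : Set B) : UniformSpace B :=
  ⨅ x ∈ J, P.supUniform.comap (fun b => x * b) ⊓ P.supUniform.comap (fun b => b * x)

/-- The requirements on the sequence `(eₙ)` in the definition of local compactness. -/
structure IsLocallyCompactBy (e : ℕ → B) : Prop where
  nonneg : ∀ n, IsPos (e n)
  le_one : ∀ n, IsPos (1 - e n)
  mulBounded : ∀ n b, b * e n ∈ P.bounded
  canonical : ∀ n m, n < m → e m * e n = e n
  tendsto_one : Tendsto e atTop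
    (@nhds B (P.idealUniform (supportAlgebra e)).toTopologicalSpace 1)
  complete : @CompleteSpace B (P.idealUniform (supportAlgebra e))
  norm_le : ∀ n b, ‖P.π n b‖ₑ ≤ ⨆ (c : B) (_ : P.supNorm (e n * c) ≤ 1), P.supNorm (e n * c * b)
  le_norm : ∀ n b, P.supNorm (e n * b) ≤ ‖P.π n b‖ₑ

end InvLimit

/-- `B` is a locally compact (unital) `σ`-`C*`-algebra. -/
def IsLocallyCompact (B : Type u) [Ring B] [StarRing B] [Algebra ℂ B] [TopologicalSpace B] :
    Prop :=
  ∃ (X : ℕ → Type u) (_ : ∀ n, CStarAlgebra (X n)) (P : InvLimit B X),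
    (∀ n, Function.Surjective (P.π n)) ∧ ∃ e : ℕ → B, P.IsLocallyCompactBy e

end LocallyCompact

section Restriction
variable {A : Type u} [NonUnitalCStarAlgebra A]

/-- The multiplier `n` is the restriction of the multiplier `m` to smaller spaces. -/
def IsRestriction {L R L' R' : Submodule ℂ A} (m : Mult L R) (n : Mult L' R') : Prop :=
  (∀ (x : L') (y : L), (x : A) = y → (n.S x : A) = m.S y) ∧
    ∀ (x : R') (y : R), (x : A) = y → (n.T x : A) = m.T y

end Restriction
end LCPro

/-!
Throughout, `e` is a canonical approximate identity, `K` the Pedersen ideal, `Lₙ = L_{eₙ}` and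
`Rₙ = R_{eₙ}`.

Since `eₙ e_m = eₙ` for `n < m`, each `x ∈ Lₙ` satisfies `x = x e_{n+1}`, so that `Lₙ ⊆ K`.
Everything rests on the converse statement `IsCanonicalApproxId.pedersenIdeal_induction`: every
element of `K` is a finite sum of products `x c` with `x` in some `Lₙ`. An element `x` of `K₊` is
dominated by a sum of elements `y_k` with right units `w_k`; by the Riesz decomposition
(`exists_riesz_decomposition`) `x = ∑ u_k* u_k` with `u_k* w_k = u_k*`. As soon as
`‖w_k - w_k e_N‖ < 1`, the equation `u_k* (1 - (w_k - w_k e_N)) = u_k* w_k e_N` can be solved for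
`u_k*`, which therefore factors through `e_N` (`IsCanonicalApproxId.eventually_factor`).

Consequently a multiplier is determined by its restrictions to the `Lₙ`, and a compatible sequence
of multipliers in the `M_{eₙ}` glues to one of `K` (`IsCanonicalApproxId.exists_glued`): the gluing
is done with functions satisfying only `x f(y) = g(x) y`, from which linearity and `f(K) ⊆ K`
follow (`IsCanonicalApproxId.exists_gamma_of_central`). The projective topologies agree because the
seminorm of each `L_a` is dominated by that of some `Lₙ` (`IsCanonicalApproxId.exists_norm_S_le`),
by a quantitative form of the factorization above.

The images of the projections of any inverse limit of a sequence of `C*`-algebras are closed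
(`InvLimit.isClosed_range`): by truncation with the functional calculus, elements of the image have
lifts bounded by twice their norm, and convergent series can be lifted term by term. This gives the
presentation with surjective morphisms. For it, `‖·‖_∞` restricts to the norm of `A`, and the
`A₀₀`-topology is the topology of pointwise convergence of the pairs `(S, T)` on `K`; its
completeness holds because `x S(y) = T(x) y` is a closed condition.

The approximate identity itself consists of functions of the strictly positive element
`∑ 2⁻ᵏ dₖ`, where `(dₖ)` is any approximate identity of positive contractions.
-/

namespace LCPro

/-! ### Riesz decomposition in unital `C*`-algebras -/

section Riesz
variable {B : Type u} [CStarAlgebra B] [PartialOrder B] [StarOrderedRing B]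

theorem norm_conj_le_norm_conj {a b : B} (ha : 0 ≤ a) (hab : a ≤ b) (c : B) :
    ‖star c * a * c‖ ≤ ‖star c * b * c‖ :=
  CStarAlgebra.norm_le_norm_of_nonneg_of_le (star_left_conjugate_nonneg ha c)
    (star_left_conjugate_le_conjugate hab c)

/-- If `q² ≤ y` then `‖q c‖² ≤ ‖c* y c‖`. -/
theorem norm_mul_sq_le {q y : B} (hq : IsSelfAdjoint q) (hqy : q * q ≤ y) (c : B) :
    ‖q * c‖ * ‖q * c‖ ≤ ‖star c * y * c‖ := by
  rw [← CStarRing.norm_star_mul_self, star_mul, hq.star_eq]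
  have h0 : 0 ≤ q * q := by simpa [hq.star_eq] using star_mul_self_nonneg q
  simpa only [mul_assoc] using norm_conj_le_norm_conj h0 hqy c

/-- The elements `g = (s + y)^{-1/2}` approximate an inverse square root of `y ≥ 0`: as `s → 0`,
`y^{1/2} g y^{1/2}` converges to `y^{1/2}`, and `1 - g y g` tends to `0` on each `v` with
`v² ≤ y`. -/
theorem exists_approx_inv_sqrt {y : B} (hy : 0 ≤ y) {s : ℝ} (hs : 0 < s) :
    ∃ g : B, IsSelfAdjoint g ∧ ‖CFC.sqrt y * g * CFC.sqrt y - CFC.sqrt y‖ ≤ √s ∧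
      ‖g * y * g‖ ≤ 1 ∧ ‖(1 - g * y * g) * y * (1 - g * y * g)‖ ≤ s := by
  have hsp : ∀ t ∈ spectrum ℝ y, 0 ≤ t := fun t ht => spectrum_nonneg_of_nonneg hy ht
  have hpos : ∀ t : ℝ, 0 < √(s + |t|) := fun t => Real.sqrt_pos.2 (by positivity)
  -- the absolute value makes `f` continuous on all of `ℝ`
  set f : ℝ → ℝ := fun t => (√(s + |t|))⁻¹ with hf
  have hfc : Continuous f := by
    rw [hf]
    exact Continuous.inv₀ (by fun_prop) fun t => (hpos t).ne'
  have hr : CFC.sqrt y = cfc Real.sqrt y := by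
    rw [CFC.sqrt_eq_real_sqrt y hy, cfcₙ_eq_cfc]
  have hyid : y = cfc (fun t : ℝ => t) y := (cfc_id' ℝ y).symm
  have hff : ∀ t : ℝ, 0 ≤ t → f t * f t = (s + t)⁻¹ := by
    intro t ht
    simp only [hf]
    rw [← mul_inv, Real.mul_self_sqrt (by positivity), abs_of_nonneg ht]
  have hgyg : cfc f y * y * cfc f y = cfc (fun t => f t * t * f t) y := by
    rw [cfc_mul _ _ y (by fun_prop) (by fun_prop), cfc_mul _ _ y (by fun_prop) (by fun_prop),
      ← hyid]
  refine ⟨cfc f y, cfc_predicate f y, ?_, ?_, ?_⟩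
  · have : CFC.sqrt y * cfc f y * CFC.sqrt y - CFC.sqrt y
        = cfc (fun t => √t * f t * √t - √t) y := by
      rw [cfc_sub _ _ y (by fun_prop) (by fun_prop), cfc_mul _ _ y (by fun_prop) (by fun_prop),
        cfc_mul _ _ y (by fun_prop) (by fun_prop), hr]
    rw [this]
    refine norm_cfc_le (Real.sqrt_nonneg _) fun t ht => ?_
    have ht0 := hsp t ht
    have h1 : √t ≤ √(s + t) := Real.sqrt_le_sqrt (by linarith)
    have h2 : √(s + t) ≤ √s + √t := by
      refine Real.sqrt_le_iff.2 ⟨by positivity, ?_⟩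
      nlinarith [Real.sq_sqrt hs.le, Real.sq_sqrt ht0,
        mul_nonneg (Real.sqrt_nonneg s) (Real.sqrt_nonneg t)]
    have h3 : 0 < √(s + t) := by simpa [abs_of_nonneg ht0] using hpos t
    have h4 : √t * f t * √t - √t = - (√t * (√(s + t) - √t) / √(s + t)) := by
      simp only [hf, abs_of_nonneg ht0]; field_simp; ring
    rw [h4, norm_neg, Real.norm_of_nonneg (by
      have := sub_nonneg.2 h1; positivity), div_le_iff₀ h3]
    nlinarith [Real.sqrt_nonneg t, Real.sqrt_nonneg s]
  · rw [hgyg]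
    refine norm_cfc_le zero_le_one fun t ht => ?_
    have ht0 := hsp t ht
    have : f t * t * f t = t / (s + t) := by
      rw [mul_right_comm, hff t ht0]; field_simp
    rw [this, Real.norm_of_nonneg (by positivity), div_le_one (by positivity)]
    linarith
  · have : (1 - cfc f y * y * cfc f y) * y * (1 - cfc f y * y * cfc f y)
        = cfc (fun t => (1 - f t * t * f t) * t * (1 - f t * t * f t)) y := by
      rw [cfc_mul _ _ y (by fun_prop) (by fun_prop), cfc_mul _ _ y (by fun_prop) (by fun_prop),
        ← hyid, cfc_sub _ _ y (by fun_prop) (by fun_prop), hgyg, cfc_const_one ℝ y (.of_nonneg hy)]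
    rw [this]
    refine norm_cfc_le hs.le fun t ht => ?_
    have ht0 := hsp t ht
    have : 1 - f t * t * f t = s / (s + t) := by
      rw [mul_right_comm, hff t ht0]; field_simp; ring
    rw [this, Real.norm_of_nonneg (by positivity)]
    have h5 : s / (s + t) ≤ 1 := by rw [div_le_one (by positivity)]; linarith
    have h6 : s / (s + t) * t ≤ s := by
      rw [div_mul_eq_mul_div, div_le_iff₀ (by positivity)]; nlinarith
    calc _ ≤ s / (s + t) * t * 1 := by gcongr
      _ ≤ s := by simpa using h6

/-- For self-adjoint `q`, `v` with `q², v² ≤ y` one has `‖q h v‖ ≤ ‖y^{1/2} h y^{1/2}‖`. -/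
theorem norm_mul_mul_le {q v y h : B} (hq : IsSelfAdjoint q) (hv : IsSelfAdjoint v)
    (hh : IsSelfAdjoint h) (hqy : q * q ≤ y) (hvy : v * v ≤ y) (hy : 0 ≤ y) :
    ‖q * h * v‖ ≤ ‖CFC.sqrt y * h * CFC.sqrt y‖ := by
  set r := CFC.sqrt y with hr
  have hrr : r * r = y := CFC.sqrt_mul_sqrt_self y hy
  have hrs : IsSelfAdjoint r := .of_nonneg (CFC.sqrt_nonneg y)
  have h1 : ‖q * h * v‖ * ‖q * h * v‖ ≤ ‖r * h * v‖ * ‖r * h * v‖ := by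
    rw [mul_assoc q]
    refine (norm_mul_sq_le hq hqy _).trans_eq ?_
    rw [← CStarRing.norm_star_mul_self, ← hrr]
    simp only [star_mul, hv.star_eq, hh.star_eq, hrs.star_eq, mul_assoc]
  have h2 : ‖r * h * v‖ = ‖v * (h * r)‖ := by
    rw [← norm_star]; simp only [star_mul, hv.star_eq, hh.star_eq, hrs.star_eq]
  have h3 : ‖r * h * v‖ * ‖r * h * v‖ ≤ ‖r * h * r‖ * ‖r * h * r‖ := by
    rw [h2]
    refine (norm_mul_sq_le hv hvy _).trans_eq ?_
    rw [← CStarRing.norm_star_mul_self, ← hrr]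
    simp only [star_mul, hh.star_eq, hrs.star_eq, mul_assoc]
  exact abs_le_of_sq_le_sq' (by nlinarith) (norm_nonneg _) |>.2

theorem one_sub_conj_selfAdjoint {y g : B} (hy : 0 ≤ y) (hg : IsSelfAdjoint g) :
    IsSelfAdjoint (1 - g * y * g) := by
  have := (IsSelfAdjoint.of_nonneg hy).star_eq
  rw [IsSelfAdjoint]; simp [hg.star_eq, this, mul_assoc]

/-- The Riesz decomposition property, in the form of a factorization: an element `v²` dominated by
`q₁² + ⋯ + qₙ²` is of the form `∑ uₖ* uₖ` with `uₖ` in the closure of `qₖ B`. -/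
theorem exists_riesz_decomposition {n : ℕ} {q : Fin n → B} {v : B}
    (hq : ∀ k, IsSelfAdjoint (q k)) (hv : IsSelfAdjoint v) (hvq : v * v ≤ ∑ k, q k * q k) :
    ∃ w : Fin n → B, (∀ k, w k ∈ closure (Set.range fun b => q k * b)) ∧
      ∑ k, star (w k) * w k = v * v := by
  set y := ∑ k, q k * q k with hydef
  have hqq : ∀ k, 0 ≤ q k * q k := fun k => by
    simpa [(hq k).star_eq] using star_mul_self_nonneg (q k)
  have hy : 0 ≤ y := Finset.sum_nonneg fun k _ => hqq k
  have hqy : ∀ k, q k * q k ≤ y := fun k =>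
    Finset.single_le_sum (f := fun k => q k * q k) (fun k _ => hqq k) (Finset.mem_univ k)
  have hs : ∀ m : ℕ, (0 : ℝ) < 1 / (m + 1) := fun m => by positivity
  choose g hg1 hg2 hg3 hg4 using fun m : ℕ => exists_approx_inv_sqrt hy (hs m)
  have hlim : Tendsto (fun m : ℕ => (1 : ℝ) / (m + 1)) atTop (𝓝 0) :=
    tendsto_one_div_add_atTop_nhds_zero_nat
  have hlim' : Tendsto (fun m : ℕ => √((1 : ℝ) / (m + 1))) atTop (𝓝 0) := by
    have := (Real.continuous_sqrt.tendsto 0).comp hlim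
    rwa [Real.sqrt_zero] at this
  have hconv : Tendsto (fun m => CFC.sqrt y * g m * CFC.sqrt y) atTop (𝓝 (CFC.sqrt y)) := by
    rw [tendsto_iff_norm_sub_tendsto_zero]
    exact squeeze_zero (fun _ => norm_nonneg _) hg2 hlim'
  have hcau : ∀ k, CauchySeq fun m => q k * g m * v := by
    intro k
    have h := hconv.cauchySeq
    rw [Metric.cauchySeq_iff] at h ⊢
    intro ε hε
    obtain ⟨N, hN⟩ := h ε hε
    refine ⟨N, fun m hm l hl => lt_of_le_of_lt ?_ (hN m hm l hl)⟩
    rw [dist_eq_norm, dist_eq_norm]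
    have := norm_mul_mul_le (hq k) hv ((hg1 m).sub (hg1 l)) (hqy k) hvq hy
    simpa only [mul_sub, sub_mul] using this
  choose w hw using fun k => cauchySeq_tendsto_of_complete (hcau k)
  refine ⟨w, fun k => mem_closure_of_tendsto (hw k) (.of_forall fun m => ⟨g m * v, ?_⟩), ?_⟩
  · simp only [mul_assoc]
  have h1 : Tendsto (fun m => ∑ k, star (q k * g m * v) * (q k * g m * v)) atTop
      (𝓝 (∑ k, star (w k) * w k)) :=
    tendsto_finsetSum _ fun k _ => (hw k).star.mul (hw k)
  have h2 : ∀ m, ∑ k, star (q k * g m * v) * (q k * g m * v)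
      = v * v - v * (1 - g m * y * g m) * v := by
    intro m
    have : v * v - v * (1 - g m * y * g m) * v = v * g m * y * g m * v := by noncomm_ring
    rw [this, hydef, Finset.mul_sum, Finset.sum_mul, Finset.sum_mul]
    refine Finset.sum_congr rfl fun k _ => ?_
    simp only [star_mul, hv.star_eq, (hg1 m).star_eq, (hq k).star_eq, mul_assoc]
  have h3 : Tendsto (fun m => v * (1 - g m * y * g m)) atTop (𝓝 0) := by
    rw [tendsto_zero_iff_norm_tendsto_zero]
    refine squeeze_zero (fun _ => norm_nonneg _) (fun m => ?_) hlim'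
    apply Real.le_sqrt_of_sq_le
    rw [pow_two]
    refine (norm_mul_sq_le hv hvq _).trans ?_
    rw [(one_sub_conj_selfAdjoint hy (hg1 m)).star_eq]
    exact hg4 m
  have h4 := (h3.mul_const v).const_sub (v * v)
  simp only [zero_mul, sub_zero] at h4
  exact tendsto_nhds_unique h1 (h4.congr fun m => (h2 m).symm)

end Riesz

/-! ### The Pedersen ideal and canonical approximate identities -/

section Hull
variable {A : Type u} [NonUnitalCStarAlgebra A]

theorem mul_mem_leftHull {a x : A} (b : A) (hx : x ∈ leftHull a) : b * x ∈ leftHull a := by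
  refine map_mem_closure (f := fun x => b * x) (by fun_prop) hx ?_
  rintro _ ⟨c, rfl⟩
  exact ⟨b * c, by simp [mul_assoc]⟩

theorem mul_self_mem_leftHull (a b : A) : b * a ∈ leftHull a :=
  subset_closure ⟨b, by simp⟩

theorem mul_self_mem_rightHull (a b : A) : a * b ∈ rightHull a :=
  subset_closure ⟨b, by simp⟩

theorem isClosed_leftHull (a : A) : IsClosed (leftHull a : Set A) :=
  Submodule.isClosed_topologicalClosure _

end Hull

section Absorb
variable {A : Type u} [NonUnitalCStarAlgebra A] [PartialOrder A] [StarOrderedRing A]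

/-- If `y w = y` with `y, w ≥ 0`, then also `y^{1/2} w = y^{1/2}`. -/
theorem sqrt_mul_eq_self {y w : A} (hy : 0 ≤ y) (hw : 0 ≤ w) (h : y * w = y) :
    CFC.sqrt y * w = CFC.sqrt y := by
  set q := CFC.sqrt y
  have hq : star q = q := (IsSelfAdjoint.of_nonneg (CFC.sqrt_nonneg y)).star_eq
  have hqq : q * q = y := CFC.sqrt_mul_sqrt_self y hy
  have hws : star w = w := (IsSelfAdjoint.of_nonneg hw).star_eq
  have hwy : w * y = y := by
    have := congrArg star h
    rwa [star_mul, hws, (IsSelfAdjoint.of_nonneg hy).star_eq] at this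
  rw [← sub_eq_zero, ← CStarRing.star_mul_self_eq_zero_iff]
  have : star (q * w - q) * (q * w - q)
      = w * (q * q) * w - w * (q * q) - (q * q) * w + q * q := by
    simp only [star_sub, star_mul, hq, hws]; noncomm_ring
  rw [this, hqq, hwy, h]; simp

theorem inr_mul_mem_range (z : A⁺¹) (a : A) : ((z * (a : A⁺¹)).snd : A⁺¹) = z * (a : A⁺¹) := by
  ext <;> simp

/-- The multiple `c • x` is carried along because the complex scalars of the span act on it, while
`K₊(A)` admits only positive multiples. -/
theorem exists_dominating_pedersenPlus {x : A} (hx : x ∈ pedersenIdeal A) (c : ℂ) :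
    ∃ q ∈ pedersenPlus A, c • x + star (c • x) ≤ q := by
  have hnsmul : ∀ (n : ℕ) {x : A}, x ∈ pedersenPlus A → (n + 1) • x ∈ pedersenPlus A := by
    intro n x hx
    induction n with
    | zero => simpa using hx
    | succ n ih => rw [succ_nsmul]; exact pedersenPlus_add ih hx
  induction hx using Submodule.span_induction generalizing c with
  | mem x hx =>
    obtain ⟨n, hn⟩ := exists_nat_ge (2 * c.re)
    refine ⟨_, hnsmul n hx, ?_⟩
    rw [star_smul, (IsSelfAdjoint.of_nonneg hx.1).star_eq, ← add_smul, ← sub_nonneg]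
    have h1 : c + star c = ((2 * c.re : ℝ) : ℂ) := by
      simpa using Complex.add_conj c
    have h2 : (n + 1) • x = ((n + 1 : ℝ) : ℂ) • x := by
      rw [← Nat.cast_smul_eq_nsmul ℂ]; simp
    rw [h1, h2, ← sub_smul, ← Complex.ofReal_sub, Complex.coe_smul]
    exact smul_nonneg (by linarith) hx.1
  | zero =>
    refine ⟨0, ⟨le_rfl, 1, le_rfl, fun _ => 0, fun _ => ⟨le_rfl, 0, le_rfl, by simp⟩, by simp⟩,
      by simp⟩
  | add x y _ _ hx hy =>
    obtain ⟨q, hq, h1⟩ := hx c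
    obtain ⟨r, hr, h2⟩ := hy c
    refine ⟨q + r, pedersenPlus_add hq hr, ?_⟩
    convert add_le_add h1 h2 using 1
    rw [smul_add, star_add]; abel
  | smul d x _ hx =>
    obtain ⟨q, hq, h⟩ := hx (c * d)
    exact ⟨q, hq, by rwa [smul_smul]⟩

/-- The positive elements of the span `K(A)` of `K₊(A)` are in `K₊(A)`. -/
theorem mem_pedersenPlus {a : A} (ha : a ∈ pedersenIdeal A) (h0 : 0 ≤ a) :
    a ∈ pedersenPlus A := by
  obtain ⟨q, hq, h⟩ := exists_dominating_pedersenPlus ha (1 / 2)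
  refine pedersenPlus_of_le h0 ?_ hq
  convert h using 1
  rw [star_smul, (IsSelfAdjoint.of_nonneg h0).star_eq, ← add_smul]
  norm_num

end Absorb

namespace IsCanonicalApproxId
variable {A : Type u} [NonUnitalCStarAlgebra A] [PartialOrder A] [StarOrderedRing A]
variable {e : ℕ → A} (he : IsCanonicalApproxId e)
include he

theorem star_eq (n : ℕ) : star (e n) = e n := (IsSelfAdjoint.of_nonneg (he.nonneg n)).star_eq

theorem canonical' {n m : ℕ} (h : n < m) : e n * e m = e n := by
  have := congrArg star (he.canonical n m h)
  rwa [star_mul, he.star_eq, he.star_eq] at this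

theorem mem_pedersenZero (n : ℕ) : e n ∈ pedersenZero A :=
  ⟨he.nonneg n, e (n + 1), he.nonneg _, he.canonical' n.lt_succ_self⟩

theorem mem_pedersenIdeal (n : ℕ) : e n ∈ pedersenIdeal A :=
  Submodule.subset_span ⟨he.nonneg n, 1, le_rfl, fun _ => e n, fun _ => he.mem_pedersenZero n,
    by simp⟩

theorem mul_eq_self {n m : ℕ} (h : n < m) {x : A} (hx : x ∈ leftHull (e n)) : x * e m = x := by
  have hcl : IsClosed {x : A | x * e m = x} := isClosed_eq (by fun_prop) (by fun_prop)
  refine closure_minimal ?_ hcl hx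
  rintro _ ⟨b, rfl⟩
  change b * e n * e m = b * e n
  rw [mul_assoc, he.canonical' h]

theorem leftHull_le_pedersenIdeal (n : ℕ) : leftHull (e n) ≤ pedersenIdeal A := by
  intro x hx
  rw [← he.mul_eq_self n.lt_succ_self hx]
  exact pedersenIdeal_mul_left _ (he.mem_pedersenIdeal _)

theorem leftHull_mono : Monotone fun n => leftHull (e n) := by
  refine monotone_nat_of_le_succ fun n x hx => ?_
  rw [← he.mul_eq_self n.lt_succ_self hx]
  exact mul_self_mem_leftHull _ _

theorem self_mem_leftHull (n : ℕ) : e n ∈ leftHull (e n) := by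
  have := mul_self_mem_leftHull (e n) (e (n + 1))
  rwa [he.canonical n _ n.lt_succ_self] at this

theorem rightHull_star_mem {n : ℕ} {x : A} : x ∈ rightHull (star (e n)) ↔ star x ∈ leftHull (e n) :=
  (StarPair.mem_iff x).symm

theorem rightHull_le_pedersenIdeal (n : ℕ) : rightHull (star (e n)) ≤ pedersenIdeal A :=
  fun x hx => by
    simpa using pedersenIdeal_star (he.leftHull_le_pedersenIdeal n (he.rightHull_star_mem.1 hx))

theorem rightHull_mono : Monotone fun n => rightHull (star (e n)) := fun _ _ h _ hx =>
  he.rightHull_star_mem.2 (he.leftHull_mono h (he.rightHull_star_mem.1 hx))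

theorem self_mem_rightHull (n : ℕ) : e n ∈ rightHull (star (e n)) := by
  rw [he.rightHull_star_mem, he.star_eq]; exact he.self_mem_leftHull n

theorem eq_of_mul_left {a b : A} (h : ∀ n, e n * a = e n * b) : a = b :=
  tendsto_nhds_unique (he.tendsto_left a) ((he.tendsto_left b).congr fun n => (h n).symm)

theorem eq_of_mul_right {a b : A} (h : ∀ n, a * e n = b * e n) : a = b :=
  tendsto_nhds_unique (he.tendsto_right a) ((he.tendsto_right b).congr fun n => (h n).symm)

/-- Every `w` which is a right unit of some elements `u` factors, on these elements, through a
member of the approximate identity. This is the reason why `K(A)` is the smallest dense ideal. -/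
theorem eventually_factor (w : A) :
    ∀ᶠ N in atTop, ∃ t : A⁺¹, ∀ u : A, u * w = u → (u : A⁺¹) = ((u * w * e N : A) : A⁺¹) * t := by
  have h := tendsto_iff_norm_sub_tendsto_zero.1 (he.tendsto_right w)
  filter_upwards [h.eventually (gt_mem_nhds one_pos)] with N hN
  have hlt : ‖((w - w * e N : A) : A⁺¹)‖ < 1 := by
    rwa [Unitization.norm_inr, norm_sub_rev]
  obtain ⟨t, ht⟩ := isUnit_one_sub_of_norm_lt_one hlt
  refine ⟨(t⁻¹ : (A⁺¹)ˣ), fun u hu => ?_⟩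
  rw [Units.eq_mul_inv_iff_mul_eq, ht, mul_sub, mul_one, ← Unitization.inr_mul,
    ← Unitization.inr_sub]
  congr 1
  rw [mul_sub, hu, ← mul_assoc, hu]; abel

/-- Every element of `K₊(A)` is a finite sum of products `x c` with `x` in some `L_{e_N}`. -/
theorem pedersenPlus_subset_span : pedersenPlus A ⊆
    Submodule.span ℂ {z : A | ∃ n, ∃ x ∈ leftHull (e n), ∃ c, z = x * c} := by
  rintro x ⟨hx0, n, -, y, hy, hxy⟩
  choose hy0 w hw0 hyw using hy
  set q : Fin n → A := fun k => CFC.sqrt (y k) with hqdef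
  have hq : ∀ k, IsSelfAdjoint (q k) := fun k => .of_nonneg (CFC.sqrt_nonneg _)
  have hqq : ∀ k, q k * q k = y k := fun k => CFC.sqrt_mul_sqrt_self (y k) (hy0 k)
  set v := CFC.sqrt x
  have hv : IsSelfAdjoint v := .of_nonneg (CFC.sqrt_nonneg _)
  have hvv : v * v = x := CFC.sqrt_mul_sqrt_self x hx0
  have hwq : ∀ k, w k * q k = q k := fun k => by
    have := congrArg star (sqrt_mul_eq_self (hy0 k) (hw0 k) (hyw k))
    rwa [star_mul, (hq k).star_eq, (IsSelfAdjoint.of_nonneg (hw0 k)).star_eq] at this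
  have hsum : ∀ g : Fin n → A, ((∑ k, g k : A) : A⁺¹) = ∑ k, (g k : A⁺¹) :=
    fun g => map_sum (Unitization.inrNonUnitalStarAlgHom ℂ A) g Finset.univ
  obtain ⟨u, hu, hus⟩ := exists_riesz_decomposition (q := fun k => (q k : A⁺¹)) (v := (v : A⁺¹))
    (fun k => (hq k).inr ℂ) (hv.inr ℂ) (by
      simp only [← Unitization.inr_mul, hvv, hqq]
      rw [← hsum, inr_le]; exact hxy)
  have hwu : ∀ k, (w k : A⁺¹) * u k = u k := fun k => by
    have hcl : IsClosed {b : A⁺¹ | (w k : A⁺¹) * b = b} := isClosed_eq (by fun_prop) (by fun_prop)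
    refine closure_minimal ?_ hcl (hu k)
    rintro _ ⟨b, rfl⟩
    change (w k : A⁺¹) * ((q k : A⁺¹) * b) = (q k : A⁺¹) * b
    rw [← mul_assoc, ← Unitization.inr_mul, hwq]
  have huA : ∀ k, ((u k).snd : A⁺¹) = u k := fun k => by
    have h0 : (u k).fst = 0 := by rw [← hwu k]; simp
    ext <;> simp [h0]
  have hx : x = ∑ k, star (u k).snd * (u k).snd := by
    apply Unitization.inr_injective (R := ℂ)
    rw [hsum]
    simp only [Unitization.inr_mul, Unitization.inr_star, huA]
    rw [hus, ← Unitization.inr_mul, hvv]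
  rw [hx]
  refine Submodule.sum_mem _ fun k _ => Submodule.subset_span ?_
  obtain ⟨N, t, ht⟩ := (he.eventually_factor (w k)).exists
  have h1 : star (u k).snd * w k = star (u k).snd := by
    have : w k * (u k).snd = (u k).snd := by
      apply Unitization.inr_injective (R := ℂ)
      rw [Unitization.inr_mul, huA, hwu]
    have := congrArg star this
    rwa [star_mul, (IsSelfAdjoint.of_nonneg (hw0 k)).star_eq] at this
  refine ⟨N, star (u k).snd * w k * e N, mul_self_mem_leftHull _ _,
    (t * ((u k).snd : A⁺¹)).snd, ?_⟩
  apply Unitization.inr_injective (R := ℂ)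
  rw [Unitization.inr_mul, Unitization.inr_mul _ (_ * e N), inr_mul_mem_range, ← mul_assoc,
    ← ht _ h1]

/-- Induction over the Pedersen ideal: its elements are the finite sums of products `x c` with `x`
in some `L_{e_n}` and `c ∈ A`. -/
theorem pedersenIdeal_induction {p : A → Prop}
    (mul : ∀ n, ∀ x ∈ leftHull (e n), ∀ c, p (x * c)) (add : ∀ x y, p x → p y → p (x + y))
    {x : A} (hx : x ∈ pedersenIdeal A) : p x := by
  have h1 : pedersenIdeal A ≤ _ := Submodule.span_le.2 he.pedersenPlus_subset_span
  have h2 : ∀ c : ℂ, p (c • x) := by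
    replace hx := h1 hx
    clear h1
    induction hx using Submodule.span_induction with
    | mem z hz =>
      obtain ⟨n, x, hx, d, rfl⟩ := hz
      intro c
      rw [← smul_mul_assoc]
      exact mul n _ (Submodule.smul_mem _ _ hx) d
    | zero => intro c; simpa using mul 0 0 (Submodule.zero_mem _) 0
    | add x y _ _ hx hy => intro c; rw [smul_add]; exact add _ _ (hx c) (hy c)
    | smul d x _ hx => intro c; rw [smul_smul]; exact hx _
  simpa using h2 1

end IsCanonicalApproxId

/-! ### The algebra of double multipliers of the Pedersen ideal -/

section GammaAlgebra
variable {A : Type u} [NonUnitalCStarAlgebra A] [PartialOrder A] [StarOrderedRing A]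

@[simp] theorem toGamma_S (a : A) (x : pedersenIdeal A) : ((toGamma a).S x : A) = a * x := rfl
@[simp] theorem toGamma_T (a : A) (x : pedersenIdeal A) : ((toGamma a).T x : A) = x * a := rfl

theorem gamma_ext {u v : Gamma A} (h1 : ∀ x, (u.S x : A) = v.S x) (h2 : ∀ x, (u.T x : A) = v.T x) :
    u = v := Mult.ext (fun x => Subtype.ext (h1 x)) fun x => Subtype.ext (h2 x)

variable (A) in
/-- The embedding of `A` in `Γ(K(A))` as a homomorphism of `*`-algebras. -/
def toGammaHom : A →⋆ₙₐ[ℂ] Gamma A where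
  toFun := toGamma
  map_smul' c a := by
    refine gamma_ext (fun x => ?_) fun x => ?_
    · exact smul_mul_assoc c a (x : A)
    · exact mul_smul_comm c (x : A) a
  map_zero' := gamma_ext (fun x => zero_mul (x : A)) fun x => mul_zero (x : A)
  map_add' a b := gamma_ext (fun x => add_mul a b (x : A)) fun x => mul_add (x : A) a b
  map_mul' a b := gamma_ext (fun x => mul_assoc a b (x : A)) fun x => (mul_assoc (x : A) a b).symm
  map_star' a := by
    refine gamma_ext (fun x => ?_) fun x => ?_
    · change star a * (x : A) = star (star (x : A) * a)
      simp
    · change (x : A) * star a = star (a * star (x : A))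
      simp

theorem toGammaHom_apply (a : A) : toGammaHom A a = toGamma a := rfl

theorem starLift_toGammaHom_inr (a : A) :
    Unitization.starLift (toGammaHom A) (a : A⁺¹) = toGamma a := by
  change algebraMap ℂ _ (a : A⁺¹).fst + toGamma (a : A⁺¹).snd = _
  simp

theorem isPos_map_of_nonneg {a : A⁺¹} (ha : 0 ≤ a) :
    IsPos (Unitization.starLift (toGammaHom A) a) := by
  refine ⟨Unitization.starLift (toGammaHom A) (CFC.sqrt a), ?_⟩
  rw [← map_star, ← map_mul, (IsSelfAdjoint.of_nonneg (CFC.sqrt_nonneg a)).star_eq,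
    CFC.sqrt_mul_sqrt_self a ha]

theorem isPos_toGamma {a : A} (ha : 0 ≤ a) : IsPos (toGamma a) := by
  rw [← starLift_toGammaHom_inr]
  exact isPos_map_of_nonneg (Unitization.inr_nonneg_iff.2 ha)

theorem isPos_one_sub_toGamma {a : A} (ha : 0 ≤ a) (h1 : ‖a‖ ≤ 1) : IsPos (1 - toGamma a) := by
  have : (a : A⁺¹) ≤ 1 := by
    rw [← CStarAlgebra.norm_le_one_iff_of_nonneg _ (Unitization.inr_nonneg_iff.2 ha),
      Unitization.norm_inr]
    exact h1
  rw [← starLift_toGammaHom_inr, ← map_one (Unitization.starLift (toGammaHom A)), ← map_sub]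
  exact isPos_map_of_nonneg (sub_nonneg.2 this)

end GammaAlgebra

namespace IsCanonicalApproxId
variable {A : Type u} [NonUnitalCStarAlgebra A] [PartialOrder A] [StarOrderedRing A]
variable {e : ℕ → A} (he : IsCanonicalApproxId e)
include he

/-- A pair of functions on `K(A)` satisfying `x f(y) = g(x) y` is automatically a double
multiplier: linearity and invariance of `K(A)` follow from the centrality relation. -/
theorem exists_gamma_of_central {f g : pedersenIdeal A → A}
    (h : ∀ x y : pedersenIdeal A, (x : A) * f y = g x * (y : A)) :
    ∃ u : Gamma A, (∀ x, (u.S x : A) = f x) ∧ ∀ x, (u.T x : A) = g x := by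
  let E : ℕ → pedersenIdeal A := fun n => ⟨e n, he.mem_pedersenIdeal n⟩
  have hE : ∀ n x, e n * f x = g (E n) * (x : A) := fun n x => h (E n) x
  have hE' : ∀ n x, g x * e n = (x : A) * f (E n) := fun n x => (h x (E n)).symm
  have fadd : ∀ x y, f (x + y) = f x + f y := fun x y => he.eq_of_mul_left fun n => by
    rw [mul_add, hE, hE, hE, Submodule.coe_add, mul_add]
  have gadd : ∀ x y, g (x + y) = g x + g y := fun x y => he.eq_of_mul_right fun n => by
    rw [add_mul, hE', hE', hE', Submodule.coe_add, add_mul]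
  have fsmul : ∀ (c : ℂ) x, f (c • x) = c • f x := fun c x => he.eq_of_mul_left fun n => by
    rw [mul_smul_comm, hE, hE, Submodule.coe_smul, mul_smul_comm]
  have gsmul : ∀ (c : ℂ) x, g (c • x) = c • g x := fun c x => he.eq_of_mul_right fun n => by
    rw [smul_mul_assoc, hE', hE', Submodule.coe_smul, smul_mul_assoc]
  have fmul : ∀ (x : pedersenIdeal A) (c : A), f ⟨x * c, pedersenIdeal_mul_right c x.2⟩ = f x * c :=
    fun x c => he.eq_of_mul_left fun n => by rw [hE, ← mul_assoc, ← mul_assoc, hE]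
  have gmul : ∀ (x : pedersenIdeal A) (c : A), g ⟨c * x, pedersenIdeal_mul_left c x.2⟩ = c * g x :=
    fun x c => he.eq_of_mul_right fun n => by rw [hE', mul_assoc, mul_assoc, hE']
  have fhull : ∀ n (x : pedersenIdeal A), (x : A) ∈ leftHull (e n) → f x ∈ leftHull (e n) :=
    fun n x hx => (isClosed_leftHull _).mem_of_tendsto (he.tendsto_left (f x))
      (.of_forall fun m => by rw [hE]; exact mul_mem_leftHull _ hx)
  have ghull : ∀ n (x : pedersenIdeal A), star (x : A) ∈ leftHull (e n) →
      star (g x) ∈ leftHull (e n) :=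
    fun n x hx => (isClosed_leftHull _).mem_of_tendsto (he.tendsto_right (g x)).star
      (.of_forall fun m => by rw [hE', star_mul]; exact mul_mem_leftHull _ hx)
  have fmem : ∀ x, f x ∈ pedersenIdeal A := by
    rintro ⟨x, hx⟩
    have : ∃ hx : x ∈ pedersenIdeal A, f ⟨x, hx⟩ ∈ pedersenIdeal A := by
      refine he.pedersenIdeal_induction (p := fun x => ∃ hx : x ∈ pedersenIdeal A, f ⟨x, hx⟩ ∈ _)
        (fun n x hx c => ⟨pedersenIdeal_mul_right c (he.leftHull_le_pedersenIdeal n hx), ?_⟩) ?_ hx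
      · rw [fmul ⟨x, he.leftHull_le_pedersenIdeal n hx⟩]
        exact pedersenIdeal_mul_right _ (he.leftHull_le_pedersenIdeal n (fhull n _ hx))
      · rintro x y ⟨hx, h1⟩ ⟨hy, h2⟩
        refine ⟨add_mem hx hy, ?_⟩
        have := fadd ⟨x, hx⟩ ⟨y, hy⟩
        rw [AddMemClass.mk_add_mk] at this
        rw [this]; exact add_mem h1 h2
    exact this.2
  have gmem : ∀ x, g x ∈ pedersenIdeal A := by
    have key : ∀ z ∈ pedersenIdeal A, ∃ hz : star z ∈ pedersenIdeal A,
        g ⟨star z, hz⟩ ∈ pedersenIdeal A := by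
      intro z hz
      refine he.pedersenIdeal_induction (p := fun z => ∃ hz : star z ∈ pedersenIdeal A,
        g ⟨star z, hz⟩ ∈ pedersenIdeal A) (fun n x hx c => ?_) ?_ hz
      · have hx' := pedersenIdeal_star (he.leftHull_le_pedersenIdeal n hx)
        rw [star_mul]
        refine ⟨pedersenIdeal_mul_left _ hx', ?_⟩
        rw [gmul ⟨star x, hx'⟩]
        refine pedersenIdeal_mul_left _ ?_
        have := ghull n ⟨star x, hx'⟩ (by simpa using hx)
        simpa using pedersenIdeal_star (he.leftHull_le_pedersenIdeal n this)
      · rintro x y ⟨hx, h1⟩ ⟨hy, h2⟩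
        rw [star_add]
        refine ⟨add_mem hx hy, ?_⟩
        have := gadd ⟨star x, hx⟩ ⟨star y, hy⟩
        rw [AddMemClass.mk_add_mk] at this
        rw [this]; exact add_mem h1 h2
    rintro ⟨x, hx⟩
    obtain ⟨h1, h2⟩ := key _ (pedersenIdeal_star hx)
    simpa using h2
  exact ⟨Mult.mk
    { toFun := fun x => ⟨f x, fmem x⟩
      map_add' := fun x y => Subtype.ext (fadd x y)
      map_smul' := fun c x => Subtype.ext (fsmul c x) }
    { toFun := fun x => ⟨g x, gmem x⟩
      map_add' := fun x y => Subtype.ext (gadd x y)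
      map_smul' := fun c x => Subtype.ext (gsmul c x) } h, fun _ => rfl, fun _ => rfl⟩

theorem mul_S (u : Gamma A) (n : ℕ) (x : pedersenIdeal A) :
    e n * (u.S x : A) = (u.T ⟨e n, he.mem_pedersenIdeal n⟩ : A) * (x : A) :=
  u.central ⟨e n, he.mem_pedersenIdeal n⟩ x

theorem T_mul (u : Gamma A) (n : ℕ) (x : pedersenIdeal A) :
    (u.T x : A) * e n = (x : A) * (u.S ⟨e n, he.mem_pedersenIdeal n⟩ : A) :=
  (u.central x ⟨e n, he.mem_pedersenIdeal n⟩).symm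

theorem S_mul_right (u : Gamma A) (x : pedersenIdeal A) (c : A) :
    (u.S ⟨x * c, pedersenIdeal_mul_right c x.2⟩ : A) = u.S x * c :=
  he.eq_of_mul_left fun n => by rw [he.mul_S, ← mul_assoc, ← mul_assoc, he.mul_S]

theorem T_mul_left (u : Gamma A) (x : pedersenIdeal A) (c : A) :
    (u.T ⟨c * x, pedersenIdeal_mul_left c x.2⟩ : A) = c * u.T x :=
  he.eq_of_mul_right fun n => by rw [he.T_mul, mul_assoc, mul_assoc, he.T_mul]

/-- Multipliers leave the closed left ideals `L_a` invariant. -/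
theorem S_mem_leftHull (u : Gamma A) {a : A} (x : pedersenIdeal A) (hx : (x : A) ∈ leftHull a) :
    (u.S x : A) ∈ leftHull a :=
  (isClosed_leftHull _).mem_of_tendsto (he.tendsto_left _)
    (.of_forall fun m => by rw [he.mul_S]; exact mul_mem_leftHull _ hx)

theorem mul_toGamma (u : Gamma A) (x : pedersenIdeal A) :
    u * toGamma (x : A) = toGamma (u.S x : A) :=
  gamma_ext (fun y => by
    rw [toGamma_S, ← he.S_mul_right]; rfl) fun y => (u.central y x).symm

theorem toGamma_mul (u : Gamma A) (x : pedersenIdeal A) :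
    toGamma (x : A) * u = toGamma (u.T x : A) :=
  gamma_ext (fun y => u.central x y) (fun y => by
    rw [toGamma_T, ← he.T_mul_left]; rfl)

end IsCanonicalApproxId

/-! ### Domination of the seminorms of the multiplier algebra -/

namespace IsCanonicalApproxId
variable {A : Type u} [NonUnitalCStarAlgebra A] [PartialOrder A] [StarOrderedRing A]
variable {e : ℕ → A} (he : IsCanonicalApproxId e)
include he

/-- If `w` is a right unit of `x`, then the size of `S(x)` is controlled by the restriction of `S`
to one `L_{e_N}`, with constants which do not depend on `x`. -/
theorem eventually_norm_S_le (w : A) : ∀ᶠ N in atTop, ∃ C : ℝ, 0 ≤ C ∧ ∀ (u : Gamma A) (M : ℝ),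
    (∀ x : pedersenIdeal A, (x : A) ∈ leftHull (e N) → ‖(u.S x : A)‖ ≤ M * ‖(x : A)‖) →
    0 ≤ M → ∀ x : pedersenIdeal A, (x : A) * w = x → ‖(u.S x : A)‖ ≤ C * M * ‖(x : A)‖ := by
  filter_upwards [he.eventually_factor w] with N ⟨t, ht⟩
  refine ⟨‖w‖ * ‖t‖, by positivity, fun u M hM hM0 x hx => ?_⟩
  have hz : (x : A) * w * e N ∈ leftHull (e N) := mul_self_mem_leftHull _ _
  set z : pedersenIdeal A := ⟨x * w * e N, he.leftHull_le_pedersenIdeal N hz⟩ with hzdef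
  have hxz : ((x : A) : A⁺¹) = ((z : A) : A⁺¹) * t := ht _ hx
  have hxz' : x = t.fst • z + ⟨z * t.snd, pedersenIdeal_mul_right _ z.2⟩ := by
    apply Subtype.ext
    have := congrArg (fun b : A⁺¹ => b.snd) hxz
    simpa using this
  have hS : ((u.S x : A) : A⁺¹) = ((u.S z : A) : A⁺¹) * t := by
    rw [hxz', map_add, map_smul, Submodule.coe_add, Submodule.coe_smul, he.S_mul_right]
    ext <;> simp
  calc ‖(u.S x : A)‖ = ‖((u.S z : A) : A⁺¹) * t‖ := by rw [← hS, Unitization.norm_inr]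
    _ ≤ ‖(u.S z : A)‖ * ‖t‖ := by
      refine (norm_mul_le _ _).trans_eq ?_
      rw [Unitization.norm_inr]
    _ ≤ M * (‖(x : A)‖ * ‖w‖ * 1) * ‖t‖ := by
      gcongr
      refine (hM z hz).trans ?_
      gcongr
      refine (norm_mul_le _ _).trans ?_
      gcongr
      · exact norm_mul_le _ _
      · exact he.norm_le_one N
    _ = ‖w‖ * ‖t‖ * M * ‖(x : A)‖ := by ring

/-- For positive `a ∈ K(A)`, the seminorm of `Γ(K(A))` given by `L_a` is dominated by the one given
by some `L_{e_N}`. With `a ≤ ∑ y_k`, `y_k w_k = y_k`, the elements of `L_a` are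
approximately `∑ x cₖ cₖ*` with contractions `cₖ` satisfying `cₖ w_k = cₖ`, and
`‖S(x)‖² ≈ ‖∑ S(x cₖ) S(x cₖ)*‖`. -/
theorem exists_norm_S_le {a : A} (ha : a ∈ pedersenIdeal A) (ha0 : 0 ≤ a) :
    ∃ (N : ℕ) (C : ℝ), 0 ≤ C ∧ ∀ (u : Gamma A) (M : ℝ),
    (∀ x : pedersenIdeal A, (x : A) ∈ leftHull (e N) → ‖(u.S x : A)‖ ≤ M * ‖(x : A)‖) →
    0 ≤ M → ∀ x : pedersenIdeal A, (x : A) ∈ leftHull a → ‖(u.S x : A)‖ ≤ C * M * ‖(x : A)‖ := by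
  obtain ⟨-, n, -, y, hy, hay⟩ := mem_pedersenPlus ha ha0
  choose hy0 w hw0 hyw using hy
  obtain ⟨N, hN⟩ := (eventually_all.2 fun k => he.eventually_norm_S_le (w k)).exists
  choose C hC0 hC using hN
  refine ⟨N, √(∑ k, C k ^ 2), Real.sqrt_nonneg _, fun u M hM hM0 x hx => ?_⟩
  have hsum : ∀ g : Fin n → A, ((∑ k, g k : A) : A⁺¹) = ∑ k, (g k : A⁺¹) :=
    fun g => map_sum (Unitization.inrNonUnitalStarAlgHom ℂ A) g Finset.univ
  set q : Fin n → A := fun k => CFC.sqrt (y k) with hqdef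
  have hq : ∀ k, star (q k) = q k := fun k => (IsSelfAdjoint.of_nonneg (CFC.sqrt_nonneg _)).star_eq
  have hqq : ∀ k, q k * q k = y k := fun k => CFC.sqrt_mul_sqrt_self (y k) (hy0 k)
  have hqw : ∀ k, q k * w k = q k := fun k => sqrt_mul_eq_self (hy0 k) (hw0 k) (hyw k)
  set Y : A⁺¹ := ((∑ k, y k : A) : A⁺¹) with hY
  have hY0 : 0 ≤ Y := Unitization.inr_nonneg_iff.2 (Finset.sum_nonneg fun k _ => hy0 k)
  have hyY : ∀ k, (y k : A⁺¹) ≤ Y := fun k => inr_le.2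
    (Finset.single_le_sum (f := y) (fun k _ => hy0 k) (Finset.mem_univ k))
  set s : A := (u.S x : A) with hs
  have hsa : s ∈ leftHull a := he.S_mem_leftHull u x hx
  have hs' : ∀ m : ℕ, (0 : ℝ) < 1 / (m + 1) := fun m => by positivity
  choose g hg1 _ hg3 hg4 using fun m : ℕ => exists_approx_inv_sqrt hY0 (hs' m)
  have hlim' : Tendsto (fun m : ℕ => √((1 : ℝ) / (m + 1))) atTop (𝓝 0) := by
    have := (Real.continuous_sqrt.tendsto 0).comp
      (tendsto_one_div_add_atTop_nhds_zero_nat (𝕜 := ℝ))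
    rwa [Real.sqrt_zero] at this
  set p : ℕ → A⁺¹ := fun m => 1 - g m * Y * g m with hp
  have hpn : ∀ m, ‖p m‖ ≤ 2 := fun m => by
    refine (norm_sub_le _ _).trans ?_
    have := hg3 m
    rw [norm_one]; linarith
  -- the elements of `L_a` are asymptotically annihilated by `p m`
  have hap : Tendsto (fun m => (a : A⁺¹) * p m) atTop (𝓝 0) := by
    set v := CFC.sqrt a
    have hv : IsSelfAdjoint v := .of_nonneg (CFC.sqrt_nonneg _)
    have hvv : v * v = a := CFC.sqrt_mul_sqrt_self a ha0
    have h1 : Tendsto (fun m => (v : A⁺¹) * p m) atTop (𝓝 0) := by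
      rw [tendsto_zero_iff_norm_tendsto_zero]
      refine squeeze_zero (fun _ => norm_nonneg _) (fun m => ?_) hlim'
      apply Real.le_sqrt_of_sq_le
      rw [pow_two]
      refine (norm_mul_sq_le (hv.inr ℂ) (y := Y) ?_ _).trans ?_
      · rw [← Unitization.inr_mul, hvv]; exact inr_le.2 hay
      · rw [(one_sub_conj_selfAdjoint hY0 (hg1 m)).star_eq]
        exact hg4 m
    have h2 := h1.const_mul (v : A⁺¹)
    rw [mul_zero] at h2
    refine h2.congr fun m => ?_
    rw [← mul_assoc, ← Unitization.inr_mul, hvv]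
  have hsp : Tendsto (fun m => (s : A⁺¹) * p m) atTop (𝓝 0) := by
    rw [Metric.tendsto_atTop]
    intro ε hε
    obtain ⟨_, ⟨d, rfl⟩, hd⟩ := Metric.mem_closure_iff.1 hsa (ε / 4) (by positivity)
    have h2 := hap.const_mul (d : A⁺¹)
    rw [mul_zero] at h2
    obtain ⟨m₀, hm₀⟩ := Metric.tendsto_atTop.1 h2 (ε / 2) (by positivity)
    refine ⟨m₀, fun m hm => ?_⟩
    have h3 := hm₀ m hm
    rw [dist_zero_right] at h3 ⊢
    have h4 : (s : A⁺¹) * p m = ((s - d * a : A) : A⁺¹) * p m + (d : A⁺¹) * ((a : A⁺¹) * p m) := by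
      rw [Unitization.inr_sub, Unitization.inr_mul]; noncomm_ring
    have h5 : ‖((s - d * a : A) : A⁺¹) * p m‖ ≤ ε / 4 * 2 := by
      refine (norm_mul_le _ _).trans (mul_le_mul ?_ (hpn m) (norm_nonneg _) (by positivity))
      rw [Unitization.norm_inr, ← dist_eq_norm]; exact hd.le
    rw [h4]
    exact (norm_add_le _ _).trans_lt (by linarith)
  set c : ℕ → Fin n → A := fun m k => (g m * (q k : A⁺¹)).snd with hc
  have hcg : ∀ m k, (c m k : A⁺¹) = g m * (q k : A⁺¹) := fun m k => inr_mul_mem_range _ _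
  have hcn : ∀ m k, ‖c m k‖ ≤ 1 := fun m k => by
    have h1 : ‖(q k : A⁺¹) * g m‖ * ‖(q k : A⁺¹) * g m‖ ≤ 1 := by
      refine (norm_mul_sq_le (IsSelfAdjoint.inr ℂ (hq k)) (y := Y) ?_ _).trans ?_
      · rw [← Unitization.inr_mul, hqq]; exact hyY k
      · rw [(hg1 m).star_eq]; exact hg3 m
    have h2 : ‖c m k‖ = ‖(q k : A⁺¹) * g m‖ := by
      rw [← Unitization.norm_inr (𝕜 := ℂ), hcg, ← norm_star, star_mul, (hg1 m).star_eq,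
        ← Unitization.inr_star, hq]
    rw [h2]
    nlinarith [norm_nonneg ((q k : A⁺¹) * g m)]
  have hcw : ∀ m k, c m k * w k = c m k := fun m k => by
    apply Unitization.inr_injective (R := ℂ)
    rw [Unitization.inr_mul, hcg, mul_assoc, ← Unitization.inr_mul, hqw]
  have hSc : ∀ m k, ‖s * c m k‖ ≤ C k * M * ‖(x : A)‖ := fun m k => by
    rw [hs, ← he.S_mul_right]
    refine (hC k u M hM hM0 _ ?_).trans ?_
    · change (x : A) * c m k * w k = (x : A) * c m k
      rw [mul_assoc, hcw]
    · have := hC0 k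
      refine mul_le_mul_of_nonneg_left ?_ (by positivity)
      refine (norm_mul_le _ _).trans ?_
      exact mul_le_of_le_one_right (norm_nonneg _) (hcn m k)
  -- `s s* = ∑ (s c_k) (s c_k)* + s p s*`, since `g Y g = 1 - p`
  have hbound : ∀ m,
      ‖s‖ * ‖s‖ ≤ (∑ k, C k ^ 2) * (M * ‖(x : A)‖) ^ 2 + ‖(s : A⁺¹) * p m‖ * ‖s‖ := by
    intro m
    have h1 : (s : A⁺¹) * star (s : A⁺¹)
        = ∑ k, ((s * c m k : A) : A⁺¹) * star ((s * c m k : A) : A⁺¹)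
        + (s : A⁺¹) * p m * star (s : A⁺¹) := by
      have h2 : ∀ k, ((s * c m k : A) : A⁺¹) * star ((s * c m k : A) : A⁺¹)
          = (s : A⁺¹) * g m * (y k : A⁺¹) * (g m * star (s : A⁺¹)) := fun k => by
        rw [Unitization.inr_mul, hcg, star_mul, star_mul, (hg1 m).star_eq, ← Unitization.inr_star
          (q k), hq, ← hqq, Unitization.inr_mul]
        simp only [mul_assoc]
      simp only [h2]
      rw [← Finset.sum_mul, ← Finset.mul_sum, ← hsum, ← hY]
      simp only [hp]
      noncomm_ring
    calc ‖s‖ * ‖s‖ = ‖(s : A⁺¹) * star (s : A⁺¹)‖ := by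
          rw [CStarRing.norm_self_mul_star, Unitization.norm_inr]
      _ ≤ ∑ k, C k ^ 2 * (M * ‖(x : A)‖) ^ 2 + ‖(s : A⁺¹) * p m‖ * ‖s‖ := by
          rw [h1]
          refine (norm_add_le _ _).trans (add_le_add ?_ ?_)
          · refine (norm_sum_le _ _).trans (Finset.sum_le_sum fun k _ => ?_)
            rw [CStarRing.norm_self_mul_star, Unitization.norm_inr]
            calc _ ≤ (C k * M * ‖(x : A)‖) * (C k * M * ‖(x : A)‖) :=
                  mul_self_le_mul_self (norm_nonneg _) (hSc m k)
              _ = _ := by ring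
          · refine (norm_mul_le _ _).trans_eq ?_
            rw [norm_star, Unitization.norm_inr]
      _ = _ := by rw [Finset.sum_mul]
  have hfin : ‖s‖ * ‖s‖ ≤ (∑ k, C k ^ 2) * (M * ‖(x : A)‖) ^ 2 := by
    have := (hsp.norm.mul_const ‖s‖).const_add ((∑ k, C k ^ 2) * (M * ‖(x : A)‖) ^ 2)
    simp only [norm_zero, zero_mul, add_zero] at this
    exact ge_of_tendsto' this hbound
  have h0 : 0 ≤ ∑ k, C k ^ 2 := Finset.sum_nonneg fun k _ => sq_nonneg _
  rw [mul_assoc]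
  refine abs_le_of_sq_le_sq' ?_ (by positivity) |>.2
  rw [mul_pow, Real.sq_sqrt h0, pow_two ‖s‖]
  exact hfin

end IsCanonicalApproxId

/-! ### Images of the projections of an inverse limit -/

namespace InvLimit
universe v
variable {B : Type u} [Ring B] [StarRing B] [Algebra ℂ B] [TopologicalSpace B]
  {X : ℕ → Type v} [∀ n, CStarAlgebra (X n)] (P : InvLimit B X)
open scoped ComplexStarModule

/-- The truncation of the real line to `[-r, r]`. -/
def truncation (r t : ℝ) : ℝ := max (-r) (min r t)

theorem continuous_truncation (r : ℝ) : Continuous (truncation r) := by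
  unfold truncation; fun_prop

theorem norm_truncation_le {r : ℝ} (hr : 0 ≤ r) (t : ℝ) : ‖truncation r t‖ ≤ r := by
  rw [Real.norm_eq_abs, abs_le]
  exact ⟨le_max_left _ _, max_le (by linarith) (min_le_left _ _)⟩

theorem truncation_eq {r t : ℝ} (h : ‖t‖ ≤ r) : truncation r t = t := by
  obtain ⟨h1, h2⟩ := abs_le.1 h
  rw [truncation, min_eq_right h2, max_eq_right h1]

/-- Truncation of the real and imaginary parts of an element of a `C*`-algebra. -/
noncomputable def truncate {Y : Type v} [CStarAlgebra Y] (r : ℝ) (x : Y) : Y :=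
  cfc (truncation r) (ℜ x : Y) + Complex.I • cfc (truncation r) (ℑ x : Y)

theorem norm_truncate_le {Y : Type v} [CStarAlgebra Y] {r : ℝ} (hr : 0 ≤ r) (x : Y) :
    ‖truncate r x‖ ≤ 2 * r := by
  refine (norm_add_le _ _).trans ?_
  rw [norm_smul, Complex.norm_I, one_mul]
  have h1 : ∀ y : Y, ‖cfc (truncation r) y‖ ≤ r := fun y =>
    norm_cfc_le hr fun t _ => norm_truncation_le hr t
  linarith [h1 (ℜ x : Y), h1 (ℑ x : Y)]

theorem truncate_eq {Y : Type v} [CStarAlgebra Y] {r : ℝ} {x : Y} (hr : ‖x‖ ≤ r) :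
    truncate r x = x := by
  have key : ∀ y : selfAdjoint Y, ‖(y : Y)‖ ≤ r → cfc (truncation r) (y : Y) = y := by
    intro y hy
    have h1 : cfc (truncation r) (y : Y) = cfc (fun t : ℝ => t) (y : Y) := by
      refine cfc_congr fun t ht => truncation_eq ?_
      refine le_trans ?_ hy
      rcases subsingleton_or_nontrivial Y with h | h
      · simp [spectrum.of_subsingleton] at ht
      exact spectrum.norm_le_norm_of_mem ht
    rw [h1, cfc_id' ℝ (y : Y) (show IsSelfAdjoint (y : Y) from y.2)]
  rw [truncate, key _ ((realPart.norm_le x).trans hr), key _ ((imaginaryPart.norm_le x).trans hr)]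
  exact realPart_add_I_smul_imaginaryPart x

theorem map_truncate {Y Z : Type v} [CStarAlgebra Y] [CStarAlgebra Z] (φ : Y →⋆ₐ[ℂ] Z) (r : ℝ)
    (x : Y) : φ (truncate r x) = truncate r (φ x) := by
  have hφ : Continuous φ := map_continuous φ
  have h1 : (ℜ (φ x) : Z) = φ (ℜ x : Y) := by
    simp only [realPart_apply_coe, ← map_star, ← map_add]
    exact (map_smul (φ.restrictScalars ℝ) _ _).symm
  have h2 : (ℑ (φ x) : Z) = φ (ℑ x : Y) := by
    simp only [imaginaryPart_apply_coe, ← map_star, ← map_sub, map_smul]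
    congr 1
    exact (map_smul (φ.restrictScalars ℝ) _ _).symm
  have key : ∀ y : selfAdjoint Y, φ (cfc (truncation r) (y : Y)) = cfc (truncation r) (φ y) := by
    intro y
    exact StarAlgHom.map_cfc (φ.restrictScalars ℝ) (truncation r) (y : Y)
      (continuous_truncation r).continuousOn hφ y.2 (y.2.map φ)
  rw [truncate, truncate, map_add, map_smul, key, key, h1, h2]

/-- Elements of the image of `π_n` lift to bounded elements of the inverse limit. -/
theorem exists_bounded_lift (n : ℕ) (b : B) :
    ∃ b', P.π n b' = P.π n b ∧ ∀ k, ‖P.π k b'‖ ≤ 2 * ‖P.π n b‖ := by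
  obtain ⟨b', hb', -⟩ := P.existsUnique (fun k => truncate ‖P.π n b‖ (P.π k b)) fun k => by
    rw [map_truncate, P.conn_π]
  exact ⟨b', (hb' n).trans (truncate_eq le_rfl),
    fun k => by rw [hb']; exact norm_truncate_le (norm_nonneg _) _⟩

/-- The images of the projections of an inverse limit of a sequence of `C*`-algebras are closed. -/
theorem isClosed_range (n : ℕ) : IsClosed (Set.range (P.π n)) := by
  refine isClosed_of_closure_subset fun x hx => ?_
  -- `x` is the sum of a series in the image, whose terms have liftings of summable norms
  have hx' : ∀ j : ℕ, ∃ b, ‖P.π n b - x‖ ≤ (1 / 2 : ℝ) ^ j := fun j => by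
    obtain ⟨_, ⟨b, rfl⟩, hb⟩ := Metric.mem_closure_iff.1 hx ((1 / 2 : ℝ) ^ j) (by positivity)
    exact ⟨b, by rw [← dist_eq_norm, dist_comm]; exact hb.le⟩
  choose b hb using hx'
  choose d hd1 hd2 using fun j => P.exists_bounded_lift n (b (j + 1) - b j)
  have hdn : ∀ j k, ‖P.π k (d j)‖ ≤ 4 * (1 / 2 : ℝ) ^ j := by
    intro j k
    have h1 : ‖P.π n (b (j + 1) - b j)‖ ≤ (1 / 2 : ℝ) ^ (j + 1) + (1 / 2 : ℝ) ^ j := by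
      have : P.π n (b (j + 1) - b j) = (P.π n (b (j + 1)) - x) - (P.π n (b j) - x) := by
        rw [map_sub]; abel
      rw [this]
      exact (norm_sub_le _ _).trans (add_le_add (hb _) (hb _))
    have h2 : (1 / 2 : ℝ) ^ (j + 1) ≤ (1 / 2 : ℝ) ^ j :=
      pow_le_pow_of_le_one (by norm_num) (by norm_num) j.le_succ
    linarith [hd2 j k]
  have hsum : ∀ k, Summable fun j => P.π k (d j) := fun k =>
    Summable.of_norm_bounded ((summable_geometric_of_lt_one (by norm_num) (by norm_num)).mul_left 4)
      fun j => hdn j k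
  obtain ⟨c, hc, -⟩ := P.existsUnique (fun k => P.π k (b 0) + ∑' j, P.π k (d j)) fun k => by
    rw [map_add, P.conn_π, (hsum (k + 1)).map_tsum _ (map_continuous (P.conn k))]
    simp only [P.conn_π]
  refine ⟨c, ?_⟩
  have hlim : Tendsto (fun j => P.π n (b j)) atTop (𝓝 x) := by
    rw [tendsto_iff_norm_sub_tendsto_zero]
    exact squeeze_zero (fun _ => norm_nonneg _) hb
      (tendsto_pow_atTop_nhds_zero_of_lt_one (by norm_num) (by norm_num))
  have h1 := (hsum n).hasSum.tendsto_sum_nat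
  have h2 : ∀ m, ∑ j ∈ Finset.range m, P.π n (d j) = P.π n (b m) - P.π n (b 0) := by
    intro m
    simp only [hd1, map_sub]
    exact Finset.sum_range_sub (fun j => P.π n (b j)) m
  simp only [h2] at h1
  rw [hc, tendsto_nhds_unique h1 (hlim.sub_const _)]
  abel

instance (n : ℕ) : IsClosed ((P.π n).range : Set (X n)) := by
  exact P.isClosed_range n

/-- The presentation of an inverse limit by the images of its projections, which are surjective
onto these images. -/
noncomputable def rangePresentation : InvLimit B fun n => (P.π n).range where
  conn n := ((P.conn n).comp (P.π (n + 1)).range.subtype).codRestrict _ (by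
    rintro ⟨_, b, rfl⟩
    exact ⟨b, (P.conn_π n b).symm⟩)
  π n := (P.π n).rangeRestrict
  conn_π n b := Subtype.ext (P.conn_π n b)
  existsUnique x hx := by
    obtain ⟨b, hb, hu⟩ := P.existsUnique (fun n => (x n : X n)) fun n => congrArg Subtype.val (hx n)
    exact ⟨b, fun n => Subtype.ext (hb n), fun c hc => hu c fun n => congrArg Subtype.val (hc n)⟩
  topology_eq := by
    rw [P.topology_eq]
    refine iInf_congr fun n => ?_
    exact (induced_compose (f := (P.π n).rangeRestrict) (g := Subtype.val)).symm

end InvLimit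

/-! ### The multiplier algebra as an inverse limit -/

section UniformOf
open Uniformity
variable {G H : Type u} [AddCommGroup G] {E : Type*} [PseudoEMetricSpace E] {p : G → ℝ≥0∞}
  (h0 : p 0 = 0) (hneg : ∀ x, p (-x) = p x) (hadd : ∀ x y, p (x + y) ≤ p x + p y)

theorem uniformity_uniformOf :
    𝓤[uniformOf p h0 hneg hadd] = ⨅ ε > 0, 𝓟 {q : G × G | p (q.1 - q.2) < ε} := rfl

theorem comap_uniformOf {f : H → G} {φ : H → E}
    (h : ∀ x y, p (f x - f y) = edist (φ x) (φ y)) :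
    (uniformOf p h0 hneg hadd).comap f = UniformSpace.comap φ inferInstance := by
  refine UniformSpace.ext ?_
  rw [uniformity_comap, uniformity_comap, uniformity_uniformOf, uniformity_pseudoedist]
  simp only [comap_iInf, comap_principal]
  refine iInf_congr fun ε => iInf_congr fun _ => congrArg 𝓟 (Set.ext fun q => ?_)
  change p (f q.1 - f q.2) < ε ↔ edist (φ q.1) (φ q.2) < ε
  rw [h]

theorem comap_le_uniformOf {φ : G → E} {C : ℝ≥0∞} (hC : C ≠ ⊤)
    (h : ∀ x y, p (x - y) ≤ C * edist (φ x) (φ y)) :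
    UniformSpace.comap φ inferInstance ≤ uniformOf p h0 hneg hadd := by
  change comap _ (𝓤 E) ≤ 𝓤[uniformOf p h0 hneg hadd]
  rw [uniformity_uniformOf]
  refine le_iInf fun ε => le_iInf fun hε => le_principal_iff.2 ?_
  -- `C + 1` in place of `C` covers the case `C = 0`
  refine ⟨{q | edist q.1 q.2 < ε / (C + 1)}, edist_mem_uniformity
    (ENNReal.div_pos hε.ne' (by finiteness)), fun q hq => ?_⟩
  refine lt_of_le_of_lt ((h q.1 q.2).trans ?_) (ENNReal.mul_lt_of_lt_div' hq)
  gcongr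
  exact le_self_add

end UniformOf

section Restrict
variable {A : Type u} [NonUnitalCStarAlgebra A]
  {L R L' R' : Submodule ℂ A} [StarPair L R] [StarPair L' R']

/-- The restriction of multipliers of `(L, R)` to a smaller pair `(L', R')` of adjoint subspaces,
when these are invariant. -/
def Mult.restrictHom (hL : L' ≤ L)
    (hS : ∀ (m : Mult L R) (x : L), (x : A) ∈ L' → (m.S x : A) ∈ L') :
    Mult L R →⋆ₐ[ℂ] Mult L' R' :=
  have hR : R' ≤ R := fun x hx =>
    (StarPair.mem_iff (L := L) x).1 (hL ((StarPair.mem_iff (R := R') x).2 hx))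
  have hT : ∀ (m : Mult L R) (x : R), (x : A) ∈ R' → (m.T x : A) ∈ R' := fun m x hx => by
    have := hS (star m) ⟨star (x : A), Mult.star_mem_left x⟩
      ((StarPair.mem_iff (R := R') (x : A)).2 hx)
    rw [Mult.star_S, StarPair.mem_iff (R := R')] at this
    simpa using this
  { toFun := fun m => Mult.mk
      { toFun := fun x => ⟨m.S ⟨x, hL x.2⟩, hS m _ x.2⟩
        map_add' := fun x y => by
          have := congrArg Subtype.val (m.S.map_add ⟨x, hL x.2⟩ ⟨y, hL y.2⟩)
          exact Subtype.ext this
        map_smul' := fun c x => by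
          have := congrArg Subtype.val (m.S.map_smul c ⟨x, hL x.2⟩)
          exact Subtype.ext this }
      { toFun := fun x => ⟨m.T ⟨x, hR x.2⟩, hT m _ x.2⟩
        map_add' := fun x y => by
          have := congrArg Subtype.val (m.T.map_add ⟨x, hR x.2⟩ ⟨y, hR y.2⟩)
          exact Subtype.ext this
        map_smul' := fun c x => by
          have := congrArg Subtype.val (m.T.map_smul c ⟨x, hR x.2⟩)
          exact Subtype.ext this }
      fun x y => m.central ⟨x, hR x.2⟩ ⟨y, hL y.2⟩
    map_one' := rfl
    map_mul' := fun _ _ => rfl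
    map_zero' := rfl
    map_add' := fun _ _ => rfl
    commutes' := fun _ => rfl
    map_star' := fun _ => rfl }

theorem Mult.isRestriction_restrictHom (hL : L' ≤ L)
    (hS : ∀ (m : Mult L R) (x : L), (x : A) ∈ L' → (m.S x : A) ∈ L') (m : Mult L R) :
    IsRestriction m (Mult.restrictHom (R' := R') hL hS m) := by
  constructor
  · rintro ⟨x, hx⟩ ⟨y, hy⟩ h
    obtain rfl : x = y := h
    rfl
  · rintro ⟨x, hx⟩ ⟨y, hy⟩ h
    obtain rfl : x = y := h
    rfl

end Restrict

namespace IsCanonicalApproxId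
variable {A : Type u} [NonUnitalCStarAlgebra A] [PartialOrder A] [StarOrderedRing A]
variable {e : ℕ → A} (he : IsCanonicalApproxId e)
include he

/-- The restriction `Γ(K(A)) → M_{e_n}`. -/
noncomputable def toHull (n : ℕ) : Gamma A →⋆ₐ[ℂ] HullMult (e n) :=
  Mult.restrictHom (he.leftHull_le_pedersenIdeal n) fun u x hx => he.S_mem_leftHull u x hx

theorem isRestriction_toHull (n : ℕ) (u : Gamma A) : IsRestriction u (he.toHull n u) :=
  Mult.isRestriction_restrictHom _ _ u

theorem toHull_S (n : ℕ) (u : Gamma A) (x : leftHull (e n)) :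
    ((he.toHull n u).S x : A) = u.S ⟨x, he.leftHull_le_pedersenIdeal n x.2⟩ := rfl

theorem toHull_T (n : ℕ) (u : Gamma A) (x : rightHull (star (e n))) :
    ((he.toHull n u).T x : A) = u.T ⟨x, he.rightHull_le_pedersenIdeal n x.2⟩ := rfl

/-- A multiplier of `(L_{e_{n+1}}, R_{e_{n+1}})` leaves `L_{e_n}` invariant: it maps
`d e_n = d e_{n+1} e_n` to `S(d e_{n+1}) e_n`. -/
theorem hullMult_S_mem (n : ℕ) (m : HullMult (e (n + 1))) (x : leftHull (e (n + 1)))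
    (hx : (x : A) ∈ leftHull (e n)) : (m.S x : A) ∈ leftHull (e n) := by
  have hmono := he.leftHull_mono n.le_succ
  have hd : ∀ d : A, (m.S ⟨d * e n, hmono (mul_self_mem_leftHull _ _)⟩ : A) ∈ leftHull (e n) := by
    intro d
    set z : leftHull (e (n + 1)) := ⟨d * e (n + 1), mul_self_mem_leftHull _ _⟩ with hz
    set z' : leftHull (e (n + 1)) := ⟨d * e n, hmono (mul_self_mem_leftHull _ _)⟩ with hz'
    have h1 : (m.S z : A) * e n ∈ leftHull (e (n + 1)) := hmono (mul_self_mem_leftHull _ _)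
    have h2 : (m.S z' : A) = m.S z * e n := by
      rw [← sub_eq_zero]
      refine HullMult.eq_zero_of_mul (a := e (n + 1)) (sub_mem (m.S z').2 h1) fun y hy => ?_
      have h3 := m.central ⟨y, hy⟩ z
      have h4 := m.central ⟨y, hy⟩ z'
      rw [mul_sub, ← mul_assoc, h3, h4]
      simp only [hz, hz', mul_assoc, he.canonical n _ n.lt_succ_self, sub_self]
    rw [h2]
    exact mul_self_mem_leftHull _ _
  obtain ⟨w, hw, hwx⟩ := mem_closure_iff_seq_limit.1 hx
  choose d hwd using hw
  replace hwd : ∀ j, d j * e n = w j := hwd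
  have hlim : Tendsto (fun j => (⟨d j * e n, hmono (mul_self_mem_leftHull _ _)⟩ :
      leftHull (e (n + 1)))) atTop (𝓝 x) := by
    rw [tendsto_subtype_rng]
    simpa only [hwd] using hwx
  have := (continuous_subtype_val.tendsto _).comp
    ((HullMult.toCLM m).continuous.tendsto x |>.comp hlim)
  exact (isClosed_leftHull _).mem_of_tendsto this (.of_forall fun j => hd (d j))

/-- The restriction `M_{e_{n+1}} → M_{e_n}`. -/
noncomputable def hullConn (n : ℕ) : HullMult (e (n + 1)) →⋆ₐ[ℂ] HullMult (e n) :=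
  Mult.restrictHom (he.leftHull_mono n.le_succ) (he.hullMult_S_mem n)

theorem isRestriction_hullConn (n : ℕ) (m : HullMult (e (n + 1))) :
    IsRestriction m (he.hullConn n m) :=
  Mult.isRestriction_restrictHom _ _ m

theorem hullConn_S (n : ℕ) (m : HullMult (e (n + 1))) (x : leftHull (e n)) :
    ((he.hullConn n m).S x : A) = m.S ⟨x, he.leftHull_mono n.le_succ x.2⟩ := rfl

theorem hullConn_T (n : ℕ) (m : HullMult (e (n + 1))) (x : rightHull (star (e n))) :
    ((he.hullConn n m).T x : A) = m.T ⟨x, he.rightHull_mono n.le_succ x.2⟩ := rfl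

section Glue
variable {m : ∀ n, HullMult (e n)} (hm : ∀ n, he.hullConn n (m (n + 1)) = m n)
include hm

theorem compatible_S {n k : ℕ} (h : n ≤ k) (x : leftHull (e n)) :
    ((m k).S ⟨x, he.leftHull_mono h x.2⟩ : A) = (m n).S x := by
  induction k, h using Nat.le_induction with
  | base => rfl
  | succ k h ih => rw [← ih, ← hm k, hullConn_S]

theorem compatible_T {n k : ℕ} (h : n ≤ k) (x : rightHull (star (e n))) :
    ((m k).T ⟨x, he.rightHull_mono h x.2⟩ : A) = (m n).T x := by
  induction k, h using Nat.le_induction with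
  | base => rfl
  | succ k h ih => rw [← ih, ← hm k, hullConn_T]

theorem central_of_compatible {n k : ℕ} (r : rightHull (star (e n))) (x : leftHull (e k)) :
    (r : A) * ((m k).S x : A) = ((m n).T r : A) * x := by
  rw [← he.compatible_S hm (le_max_right n k), ← he.compatible_T hm (le_max_left n k)]
  exact (m (max n k)).central ⟨r, _⟩ ⟨x, _⟩

/-- A compatible sequence of multipliers `(Sₙ, Tₙ)` determines the value `s = S(z)` for each
`z ∈ K(A)` by `r s = Tₙ(r) z`. Any `y, t` with `t x = y Sₙ(x)` satisfy `y S(z) = t z`. -/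
theorem exists_glued_value {y t : A} (ht : ∀ n (x : leftHull (e n)), t * x = y * (m n).S x) {z : A}
    (hz : z ∈ pedersenIdeal A) :
    ∃ s, (∀ n (r : rightHull (star (e n))), (r : A) * s = (m n).T r * z) ∧ y * s = t * z := by
  refine he.pedersenIdeal_induction (p := fun z => ∃ s,
    (∀ n (r : rightHull (star (e n))), (r : A) * s = (m n).T r * z) ∧ y * s = t * z)
    (fun k x hx c => ?_) ?_ hz
  · refine ⟨(m k).S ⟨x, hx⟩ * c, fun n r => ?_, ?_⟩
    · rw [← mul_assoc, he.central_of_compatible hm r ⟨x, hx⟩, mul_assoc]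
    · rw [← mul_assoc, ← ht k ⟨x, hx⟩, mul_assoc]
  · rintro x y ⟨s, hs, hs'⟩ ⟨s', h, h'⟩
    refine ⟨s + s', fun n r => ?_, ?_⟩
    · rw [mul_add, mul_add, hs, h]
    · rw [mul_add, mul_add, hs', h']

/-- The counterpart of `exists_glued_value` for the second components, with `t = T(y)`; it is that
lemma for the adjoints of the given multipliers. -/
theorem exists_glued_value_right {y : A} (hy : y ∈ pedersenIdeal A) :
    ∃ t, ∀ n (x : leftHull (e n)), t * x = y * (m n).S x := by
  have hm' : ∀ n, he.hullConn n (star (m (n + 1))) = star (m n) := fun n => by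
    rw [map_star, hm]
  obtain ⟨s, hs, -⟩ := he.exists_glued_value (m := fun n => star (m n)) hm' (y := 0) (t := 0)
    (by simp) (pedersenIdeal_star hy)
  refine ⟨star s, fun n x => ?_⟩
  have := congrArg star (hs n ⟨star (x : A), Mult.star_mem_right x⟩)
  rw [Mult.star_T] at this
  simpa using this

theorem exists_glued : ∃ u : Gamma A, ∀ n, he.toHull n u = m n := by
  choose g hg using fun y : pedersenIdeal A => he.exists_glued_value_right hm y.2
  choose f hf _ using fun z : pedersenIdeal A =>
    he.exists_glued_value hm (y := 0) (t := 0) (by simp) z.2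
  have huniq : ∀ s s' z : A, (∀ n (r : rightHull (star (e n))), (r : A) * s = (m n).T r * z) →
      (∀ n (r : rightHull (star (e n))), (r : A) * s' = (m n).T r * z) → s = s' :=
    fun s s' z h h' => he.eq_of_mul_left fun n => by
      rw [h n ⟨e n, he.self_mem_rightHull n⟩, h' n ⟨e n, he.self_mem_rightHull n⟩]
  obtain ⟨u, hu, -⟩ := he.exists_gamma_of_central (f := f) (g := g) fun y z => by
    obtain ⟨s, hs, hs'⟩ := he.exists_glued_value hm (hg y) z.2
    rw [huniq _ _ _ (hf z) hs, hs']
  refine ⟨u, fun n => HullMult.T_unique fun x => Subtype.ext ?_⟩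
  rw [toHull_S, hu]
  exact huniq _ _ _ (hf _) fun k r => he.central_of_compatible hm r x

end Glue

theorem toHull_injective {u v : Gamma A} (h : ∀ n, he.toHull n u = he.toHull n v) : u = v := by
  have hS : ∀ {u v : Gamma A}, (∀ n, he.toHull n u = he.toHull n v) →
      ∀ x, (u.S x : A) = v.S x := by
    rintro u v h ⟨x, hx⟩
    have : ∃ hx : x ∈ pedersenIdeal A, (u.S ⟨x, hx⟩ : A) = v.S ⟨x, hx⟩ := by
      refine he.pedersenIdeal_induction (p := fun x => ∃ hx : x ∈ pedersenIdeal A,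
        (u.S ⟨x, hx⟩ : A) = v.S ⟨x, hx⟩) (fun n x hx c => ?_) ?_ hx
      · have hxK := he.leftHull_le_pedersenIdeal n hx
        refine ⟨pedersenIdeal_mul_right c hxK, ?_⟩
        rw [he.S_mul_right u ⟨x, hxK⟩, he.S_mul_right v ⟨x, hxK⟩, ← he.toHull_S n u ⟨x, hx⟩, h,
          he.toHull_S]
      · rintro x y ⟨hx, h1⟩ ⟨hy, h2⟩
        refine ⟨add_mem hx hy, ?_⟩
        rw [← AddMemClass.mk_add_mk _ x y hx hy, map_add, map_add, Submodule.coe_add, h1, h2,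
          Submodule.coe_add]
    exact this.2
  refine gamma_ext (hS h) fun x => ?_
  have := hS (u := star u) (v := star v) (fun n => by rw [map_star, map_star, h])
    ⟨star (x : A), Mult.star_mem_left x⟩
  rw [Mult.star_S, Mult.star_S, star_inj] at this
  simpa using this

/-- The seminorm of `Γ(K(A))` given by `L_{e_n}` is the norm of the restriction in `M_{e_n}`. -/
theorem hullSeminorm_eq (n : ℕ) (u : Gamma A) : hullSeminorm (e n) u = ‖he.toHull n u‖ₑ := by
  refine le_antisymm (iSup_le fun x => iSup_le fun h1 => iSup_le fun h2 => ?_) ?_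
  · rw [← he.toHull_S n u ⟨x, h1⟩]
    rw [enorm_le_iff_norm_le]
    refine (HullMult.norm_S_le _ _).trans ?_
    exact mul_le_of_le_one_right (norm_nonneg _) h2
  · by_cases htop : hullSeminorm (e n) u = ⊤
    · rw [htop]; exact le_top
    rw [← ofReal_norm]
    refine ENNReal.ofReal_le_of_le_toReal ?_
    rw [HullMult.norm_def]
    refine ContinuousLinearMap.opNorm_le_of_unit_norm ENNReal.toReal_nonneg fun x hx => ?_
    change ‖((he.toHull n u).S x : A)‖ ≤ _
    rw [he.toHull_S, ← toReal_enorm]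
    refine ENNReal.toReal_mono htop ?_
    exact le_iSup_of_le ⟨x, he.leftHull_le_pedersenIdeal n x.2⟩
      (le_iSup_of_le x.2 (le_iSup_of_le hx.le le_rfl))

/-- The projective topology, defined by all the `L_a` with `a ≥ 0` in `K(A)`, is already defined by
the `L_{e_n}`. -/
theorem topology_eq : (inferInstance : TopologicalSpace (Gamma A)) =
    ⨅ n, TopologicalSpace.induced (he.toHull n) inferInstance := by
  refine le_antisymm (le_iInf fun n => ?_) (le_iInf fun a => le_iInf fun ha => ?_)
  · refine iInf₂_le_of_le (e n) ⟨he.mem_pedersenIdeal n, he.nonneg n⟩ (le_of_eq ?_)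
    rw [← UniformSpace.toTopologicalSpace_comap]
    congr 1
    refine (congrFun uniformSpace_comap_id _).symm.trans
      (comap_uniformOf (hullSeminorm_zero _) (hullSeminorm_neg _) (hullSeminorm_add _)
        (f := id) (φ := he.toHull n) fun x y => ?_)
    · rw [edist_eq_enorm_sub, ← map_sub, ← he.hullSeminorm_eq]; rfl
  · obtain ⟨N, C, hC0, hC⟩ := he.exists_norm_S_le ha.1 ha.2
    refine iInf_le_of_le N ?_
    rw [← UniformSpace.toTopologicalSpace_comap]
    refine UniformSpace.toTopologicalSpace_mono ?_
    refine comap_le_uniformOf _ _ _ (C := ENNReal.ofReal C) ENNReal.ofReal_ne_top fun x y => ?_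
    rw [edist_eq_enorm_sub, ← map_sub]
    refine iSup_le fun z => iSup_le fun h1 => iSup_le fun h2 => ?_
    rw [← ofReal_norm, ← ofReal_norm, ← ENNReal.ofReal_mul hC0]
    refine ENNReal.ofReal_le_ofReal ?_
    refine (hC (x - y) ‖he.toHull N (x - y)‖ (fun w hw => ?_) (norm_nonneg _) z h1).trans ?_
    · exact HullMult.norm_S_le (he.toHull N (x - y)) ⟨w, hw⟩
    · exact mul_le_of_le_one_right (by positivity) h2

/-- `Γ(K(A))` is the inverse limit of the `C*`-algebras `M_{e_n}`. -/
noncomputable def invLimit : InvLimit (Gamma A) fun n => HullMult (e n) where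
  conn := he.hullConn
  π := he.toHull
  conn_π n u := rfl
  existsUnique m hm := by
    obtain ⟨u, hu⟩ := he.exists_glued hm
    exact ⟨u, hu, fun v hv => he.toHull_injective fun n => by rw [hu, hv]⟩
  topology_eq := he.topology_eq

end IsCanonicalApproxId

/-! ### Existence of a canonical approximate identity -/

section Existence
variable {A : Type u} [NonUnitalCStarAlgebra A] [PartialOrder A] [StarOrderedRing A]

/-- The piecewise linear function which is `0` on `(-∞, 2⁻⁽ⁿ⁺¹⁾]` and `1` on `[2⁻ⁿ, ∞)`. -/
noncomputable def plateau (n : ℕ) (t : ℝ) : ℝ := max 0 (min 1 (2 ^ (n + 1) * t - 1))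

theorem continuous_plateau (n : ℕ) : Continuous (plateau n) := by
  unfold plateau; fun_prop

theorem plateau_zero (n : ℕ) : plateau n 0 = 0 := by simp [plateau]

theorem plateau_nonneg (n : ℕ) (t : ℝ) : 0 ≤ plateau n t := le_max_left _ _

theorem plateau_le_one (n : ℕ) (t : ℝ) : plateau n t ≤ 1 := max_le zero_le_one (min_le_left _ _)

theorem plateau_eq_one {n : ℕ} {t : ℝ} (h : 2 ≤ 2 ^ (n + 1) * t) : plateau n t = 1 := by
  rw [plateau, min_eq_left (by linarith), max_eq_right zero_le_one]

theorem plateau_eq_zero {n : ℕ} {t : ℝ} (h : 2 ^ (n + 1) * t ≤ 1) : plateau n t = 0 := by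
  rw [plateau, max_eq_left ((min_le_right _ _).trans (by linarith))]

theorem plateau_mul_plateau {n m : ℕ} (h : n < m) {t : ℝ} (ht : 0 ≤ t) :
    plateau m t * plateau n t = plateau n t := by
  rcases le_total (2 ^ (n + 1) * t) 1 with h1 | h1
  · rw [plateau_eq_zero h1, mul_zero]
  · rw [plateau_eq_one (n := m), one_mul]
    have : (2 : ℝ) ^ (n + 1 + 1) ≤ 2 ^ (m + 1) := pow_le_pow_right₀ one_le_two (by omega)
    calc (2 : ℝ) ≤ 2 ^ (n + 1 + 1) * t := by rw [pow_succ]; linarith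
      _ ≤ _ := by gcongr

theorem one_sub_plateau_mul_le (n : ℕ) {t : ℝ} (ht : 0 ≤ t) :
    (1 - plateau n t) * t * (1 - plateau n t) ≤ (1 / 2) ^ n := by
  rcases le_total 2 (2 ^ (n + 1) * t) with h1 | h1
  · rw [plateau_eq_one h1]; simp
  · have h2 : t ≤ (1 / 2) ^ n := by
      rw [pow_succ] at h1
      have h : (1 / 2 : ℝ) ^ n * 2 ^ n = 1 := by rw [← mul_pow]; norm_num
      calc t = (1 / 2) ^ n * (2 ^ n * t) := by rw [← mul_assoc, h, one_mul]
        _ ≤ (1 / 2) ^ n * 1 := by gcongr; linarith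
        _ = _ := mul_one _
    have h3 := plateau_nonneg n t
    have h4 := plateau_le_one n t
    have h5 : (1 - plateau n t) * t ≤ t := mul_le_of_le_one_left ht (by linarith)
    have h6 : 0 ≤ (1 - plateau n t) * t := mul_nonneg (by linarith) ht
    calc _ ≤ (1 - plateau n t) * t := mul_le_of_le_one_right h6 (by linarith)
      _ ≤ _ := h5.trans h2

theorem norm_one_sub_plateau_conj_le {h : A} (hh0 : 0 ≤ h) (n : ℕ) :
    ‖(1 - ((cfcₙ (plateau n) h : A) : A⁺¹)) * (h : A⁺¹) * (1 - ((cfcₙ (plateau n) h : A) : A⁺¹))‖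
      ≤ (1 / 2 : ℝ) ^ n := by
  have hqs : ∀ t ∈ quasispectrum ℝ h, 0 ≤ t := fun t ht => quasispectrum_nonneg_of_nonneg h hh0 t ht
  have hc : ContinuousOn (plateau n) (quasispectrum ℝ h) := (continuous_plateau n).continuousOn
  have h0 := plateau_zero n
  set b := cfcₙ (plateau n) h with hb
  have h1 : (1 - (b : A⁺¹)) * (h : A⁺¹) * (1 - (b : A⁺¹))
      = ((h - b * h - h * b + b * h * b : A) : A⁺¹) := by
    simp only [Unitization.inr_sub, Unitization.inr_add, Unitization.inr_mul]
    noncomm_ring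
  have h2 : h - b * h - h * b + b * h * b
      = cfcₙ (fun t => t - plateau n t * t - t * plateau n t
          + plateau n t * t * plateau n t) h := by
    rw [cfcₙ_add _ _ h, cfcₙ_sub _ _ h, cfcₙ_sub _ _ h, cfcₙ_mul (fun t => plateau n t * t) _ h,
      cfcₙ_mul _ (fun t => t) h, cfcₙ_mul (fun t => t) _ h, cfcₙ_id' ℝ h]
  rw [h1, Unitization.norm_inr, h2]
  refine norm_cfcₙ_le fun t ht => ?_
  have ht0 := hqs t ht
  have h3 : t - plateau n t * t - t * plateau n t + plateau n t * t * plateau n t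
      = (1 - plateau n t) * t * (1 - plateau n t) := by ring
  have h4 : 0 ≤ 1 - plateau n t := by linarith [plateau_le_one n t]
  rw [h3, Real.norm_of_nonneg (by positivity)]
  exact one_sub_plateau_mul_le n ht0

/-- If `(1 - eₙ) h (1 - eₙ) → 0` then `eₙ d → d` for all positive `d` dominated by a multiple
of `h`. -/
theorem tendsto_mul_of_le_smul {e : ℕ → A} (hes : ∀ n, star (e n) = e n) {h : A} {ε : ℕ → ℝ}
    (hh : ∀ n, ‖(1 - (e n : A⁺¹)) * (h : A⁺¹) * (1 - (e n : A⁺¹))‖ ≤ ε n)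
    (hε : Tendsto ε atTop (𝓝 0)) {d : A} (hd : 0 ≤ d) {c : ℝ} (hc : 0 ≤ c) (hdh : d ≤ c • h) :
    Tendsto (fun n => e n * d) atTop (𝓝 d) := by
  set q := CFC.sqrt d
  have hq : IsSelfAdjoint q := .of_nonneg (CFC.sqrt_nonneg _)
  have hqq : q * q = d := CFC.sqrt_mul_sqrt_self _ hd
  have h1 : ∀ n, ‖q - q * e n‖ ≤ √(c * ε n) := by
    intro n
    have h2 : ((q - q * e n : A) : A⁺¹) = (q : A⁺¹) * (1 - (e n : A⁺¹)) := by
      rw [Unitization.inr_sub, Unitization.inr_mul, mul_sub, mul_one]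
    rw [← Unitization.norm_inr (𝕜 := ℂ), h2]
    apply Real.le_sqrt_of_sq_le
    rw [pow_two]
    refine (norm_mul_sq_le (hq.inr ℂ) (y := ((c • h : A) : A⁺¹)) ?_ _).trans ?_
    · rw [← Unitization.inr_mul, hqq, inr_le]
      exact hdh
    · have h3 : star (1 - (e n : A⁺¹)) = 1 - (e n : A⁺¹) := by
        rw [star_sub, star_one, ← Unitization.inr_star, hes]
      rw [h3, Unitization.inr_smul, mul_smul_comm, smul_mul_assoc, norm_smul,
        Real.norm_of_nonneg hc]
      exact mul_le_mul_of_nonneg_left (hh n) hc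
  have h4 : Tendsto (fun n => q - q * e n) atTop (𝓝 0) := by
    rw [tendsto_zero_iff_norm_tendsto_zero]
    refine squeeze_zero (fun _ => norm_nonneg _) h1 ?_
    have := (Real.continuous_sqrt.tendsto _).comp (hε.const_mul c)
    rwa [mul_zero, Real.sqrt_zero] at this
  have h5 := (h4.star.mul_const q).const_sub d
  simp only [star_zero, zero_mul, sub_zero, star_sub, star_mul, hq.star_eq, hes, sub_mul, hqq,
    mul_assoc, sub_sub_cancel] at h5
  exact h5

/-- A `σ`-unital `C*`-algebra has a canonical approximate identity: functions `fₙ(h)` of the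
strictly positive element `h = ∑ 2⁻ᵏ eₖ`. -/
theorem exists_isCanonicalApproxId (hσ : IsSigmaUnital A) : ∃ e : ℕ → A, IsCanonicalApproxId e := by
  obtain ⟨d, hd0, hd1, hd⟩ := hσ
  have hsum : Summable fun k => (1 / 2 : ℝ) ^ k • d k := by
    refine Summable.of_norm_bounded
      (summable_geometric_of_lt_one (r := 1 / 2) (by norm_num) (by norm_num)) fun k => ?_
    rw [norm_smul, Real.norm_of_nonneg (by positivity)]
    exact mul_le_of_le_one_right (by positivity) (hd1 k)
  set h : A := ∑' k, (1 / 2 : ℝ) ^ k • d k with hdef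
  have hterm : ∀ k, 0 ≤ (1 / 2 : ℝ) ^ k • d k := fun k => smul_nonneg (by positivity) (hd0 k)
  have hh0 : 0 ≤ h := tsum_nonneg hterm
  have hdh : ∀ k, (1 / 2 : ℝ) ^ k • d k ≤ h := fun k => hsum.le_tsum k fun j _ => hterm j
  set e : ℕ → A := fun n => cfcₙ (plateau n) h with he
  have hqs : ∀ t ∈ quasispectrum ℝ h, 0 ≤ t := fun t ht => quasispectrum_nonneg_of_nonneg h hh0 t ht
  have hc : ∀ n, ContinuousOn (plateau n) (quasispectrum ℝ h) :=
    fun n => (continuous_plateau n).continuousOn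
  have he0 : ∀ n, 0 ≤ e n := fun n => cfcₙ_nonneg fun t _ => plateau_nonneg n t
  have he1 : ∀ n, ‖e n‖ ≤ 1 := fun n => norm_cfcₙ_le fun t _ => by
    rw [Real.norm_of_nonneg (plateau_nonneg n t)]; exact plateau_le_one n t
  have hes : ∀ n, star (e n) = e n := fun n => (IsSelfAdjoint.of_nonneg (he0 n)).star_eq
  have hcan : ∀ n m, n < m → e m * e n = e n := fun n m hnm => by
    rw [he]
    simp only
    rw [← cfcₙ_mul (plateau m) (plateau n) h (hc m) (plateau_zero m) (hc n) (plateau_zero n)]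
    exact cfcₙ_congr fun t ht => plateau_mul_plateau hnm (hqs t ht)
  have hlim : Tendsto (fun n : ℕ => (1 / 2 : ℝ) ^ n) atTop (𝓝 0) :=
    tendsto_pow_atTop_nhds_zero_of_lt_one (by norm_num) (by norm_num)
  have hed : ∀ k, Tendsto (fun n => e n * d k) atTop (𝓝 (d k)) := fun k =>
    tendsto_mul_of_le_smul hes (norm_one_sub_plateau_conj_le hh0) hlim (hd0 k)
      (c := 2 ^ k) (by positivity) (by
        have := smul_le_smul_of_nonneg_left (hdh k) (a := (2 : ℝ) ^ k) (by positivity)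
        rwa [smul_smul, ← mul_pow, mul_one_div_cancel two_ne_zero, one_pow, one_smul] at this)
  have hleft : ∀ a, Tendsto (fun n => e n * a) atTop (𝓝 a) := by
    intro a
    rw [Metric.tendsto_atTop]
    intro ε hε
    obtain ⟨k, hk⟩ := ((Metric.tendsto_atTop.1 (hd a).1 (ε / 3) (by positivity)).imp
      fun k hk => hk k le_rfl)
    have h1 := (hed k).mul_const a
    obtain ⟨N, hN⟩ := Metric.tendsto_atTop.1 h1 (ε / 3) (by positivity)
    refine ⟨N, fun n hn => ?_⟩
    have h2 := hN n hn
    rw [dist_eq_norm] at hk h2 ⊢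
    have h3 : e n * a - a = -(e n * (d k * a - a)) + (e n * d k * a - d k * a) + (d k * a - a) := by
      rw [mul_sub, mul_assoc]; abel
    have h4 : ‖-(e n * (d k * a - a))‖ ≤ 1 * ‖d k * a - a‖ := by
      rw [norm_neg]
      exact (norm_mul_le _ _).trans (by gcongr; exact he1 n)
    rw [h3]
    have h5 := norm_add_le (-(e n * (d k * a - a)) + (e n * d k * a - d k * a)) (d k * a - a)
    have h6 := norm_add_le (-(e n * (d k * a - a))) (e n * d k * a - d k * a)
    linarith
  refine ⟨e, he0, he1, hcan, hleft, fun a => ?_⟩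
  have := (hleft (star a)).star
  simpa only [star_mul, star_star, hes] using this

end Existence

/-! ### Local compactness -/

/-- The norm of `(S, T) ∈ M_a` is bounded by each bound of `T` on `a* A`. -/
theorem HullMult.norm_le_of_T {A : Type u} [NonUnitalCStarAlgebra A] {a : A} (m : HullMult a)
    {M : ℝ} (hM : 0 ≤ M) (h : ∀ d : A,
      ‖(m.T ⟨star a * d, mul_self_mem_rightHull _ _⟩ : A)‖ ≤ M * ‖star a * d‖) : ‖m‖ ≤ M := by
  rw [← norm_star, HullMult.norm_def]
  refine ContinuousLinearMap.opNorm_le_bound _ hM fun x => ?_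
  have hd : ∀ d : A,
      ‖HullMult.toCLM (star m) ⟨d * a, mul_self_mem_leftHull _ _⟩‖ ≤ M * ‖d * a‖ := by
    intro d
    have h1 := h (star d)
    have h2 : ‖star a * star d‖ = ‖d * a‖ := by rw [← star_mul, norm_star]
    rw [h2] at h1
    refine le_trans (le_of_eq ?_) h1
    change ‖((star m).S _ : A)‖ = _
    rw [Mult.star_S, norm_star]
    congr 4
    exact star_mul d a
  obtain ⟨w, hw, hwx⟩ := mem_closure_iff_seq_limit.1 x.2
  choose d hwd using hw
  replace hwd : ∀ j, d j * a = w j := hwd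
  have hlim : Tendsto (fun j => (⟨d j * a, mul_self_mem_leftHull _ _⟩ : leftHull a)) atTop
      (𝓝 x) := by
    rw [tendsto_subtype_rng]
    simpa only [hwd] using hwx
  have h1 := (((HullMult.toCLM (star m)).continuous.tendsto x).comp hlim).norm
  exact le_of_tendsto_of_tendsto' h1 (hlim.norm.const_mul M) fun j => hd (d j)

/-- The pair of maps `(S, T)` of a multiplier, as functions on the Pedersen ideal. -/
def gammaMaps {A : Type u} [NonUnitalCStarAlgebra A] [PartialOrder A] [StarOrderedRing A]
    (u : Gamma A) : (pedersenIdeal A → A) × (pedersenIdeal A → A) :=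
  (fun x => u.S x, fun x => u.T x)

namespace IsCanonicalApproxId
variable {A : Type u} [NonUnitalCStarAlgebra A] [PartialOrder A] [StarOrderedRing A]
variable {e : ℕ → A} (he : IsCanonicalApproxId e)
include he

/-- The support algebra of the canonical approximate identity is the Pedersen ideal. -/
theorem supportAlgebra_eq : supportAlgebra (fun n => toGamma (e n)) =
    toGamma '' (pedersenIdeal A : Set A) := by
  have hsucc : ∀ n, toGamma (e (n + 1)) ^ 2 * toGamma (e n) = toGamma (e n) := fun n => by
    simp only [← toGammaHom_apply, pow_two, ← map_mul, mul_assoc, he.canonical n _ n.lt_succ_self]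
  refine Set.Subset.antisymm (Set.iUnion_subset fun n => ?_) ?_
  · have : Submodule.span ℂ {z : Gamma A | ∃ b c : Gamma A, z = b * toGamma (e n) ^ 2 * c} ≤
        (pedersenIdeal A).map (toGammaHom A : A →ₗ[ℂ] Gamma A) := by
      refine Submodule.span_le.2 ?_
      rintro _ ⟨b, c, rfl⟩
      let x : pedersenIdeal A :=
        ⟨e n * e n, pedersenIdeal_mul_left _ (he.mem_pedersenIdeal n)⟩
      refine ⟨c.T (b.S x), (c.T (b.S x)).2, ?_⟩
      have h1 : toGamma (e n) ^ 2 = toGamma (x : A) := by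
        rw [pow_two]; exact (map_mul (toGammaHom A) (e n) (e n)).symm
      rw [h1, he.mul_toGamma, he.toGamma_mul]
      rfl
    intro z hz
    obtain ⟨x, hx, hxz⟩ := this hz
    exact ⟨x, hx, hxz⟩
  · rintro _ ⟨x, hx, rfl⟩
    set V : ℕ → Submodule ℂ (Gamma A) := fun n =>
      Submodule.span ℂ {z : Gamma A | ∃ b c : Gamma A, z = b * toGamma (e n) ^ 2 * c}
    have hV : Monotone V := monotone_nat_of_le_succ fun n => Submodule.span_mono (by
      rintro _ ⟨b, c, rfl⟩
      refine ⟨b, toGamma (e n) ^ 2 * c, ?_⟩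
      have h : toGamma (e (n + 1)) ^ 2 * toGamma (e n) ^ 2 = toGamma (e n) ^ 2 := by
        rw [pow_two (toGamma (e n)), ← mul_assoc, hsucc]
      rw [← mul_assoc, mul_assoc b (toGamma (e (n + 1)) ^ 2), h])
    have key : ∃ n, toGamma x ∈ V n := by
      refine he.pedersenIdeal_induction (p := fun x => ∃ n, toGamma x ∈ V n)
        (fun n x hx c => ⟨n + 1, Submodule.subset_span ⟨toGamma x, toGamma c, ?_⟩⟩) ?_ hx
      · simp only [← toGammaHom_apply, pow_two, ← map_mul, ← mul_assoc,
          he.mul_eq_self n.lt_succ_self hx]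
      · rintro x y ⟨n, hn⟩ ⟨k, hk⟩
        refine ⟨max n k, ?_⟩
        rw [← toGammaHom_apply, map_add]
        exact add_mem (hV (le_max_left _ _) hn) (hV (le_max_right _ _) hk)
    exact Set.mem_iUnion.2 key

theorem norm_rangePresentation (n : ℕ) (u : Gamma A) :
    ‖he.invLimit.rangePresentation.π n u‖ₑ = ‖he.toHull n u‖ₑ := rfl

theorem norm_toHull_toGamma_le (n : ℕ) (a : A) : ‖he.toHull n (toGamma a)‖ ≤ ‖a‖ := by
  rw [HullMult.norm_def]
  exact ContinuousLinearMap.opNorm_le_bound _ (norm_nonneg _) fun x => norm_mul_le a (x : A)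

theorem supNorm_toGamma (a : A) :
    he.invLimit.rangePresentation.supNorm (toGamma a) = ‖a‖ₑ := by
  refine le_antisymm (iSup_le fun n => ?_) ?_
  · rw [norm_rangePresentation, enorm_le_iff_norm_le]
    exact he.norm_toHull_toGamma_le n a
  · refine le_of_tendsto' (he.tendsto_right a).enorm fun n => ?_
    refine le_trans ?_ (le_iSup _ n)
    rw [norm_rangePresentation, enorm_le_iff_norm_le]
    refine (HullMult.norm_S_le (he.toHull n (toGamma a)) ⟨e n, he.self_mem_leftHull n⟩).trans ?_
    exact mul_le_of_le_one_right (norm_nonneg _) (he.norm_le_one n)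

/-- The uniform structure of the `K(A)`-topology on `Γ(K(A))` is that of pointwise convergence of
both components of a multiplier. -/
theorem idealUniform_eq : he.invLimit.rangePresentation.idealUniform
    (supportAlgebra fun n => toGamma (e n)) = UniformSpace.comap gammaMaps inferInstance := by
  set Q := he.invLimit.rangePresentation
  have h1 : ∀ k : pedersenIdeal A, Q.supUniform.comap (fun b => toGamma (k : A) * b) =
      UniformSpace.comap (fun b : Gamma A => (b.T k : A)) inferInstance := fun k =>
    comap_uniformOf Q.supNorm_zero Q.supNorm_neg Q.supNorm_add fun x y => by
      rw [he.toGamma_mul, he.toGamma_mul, edist_eq_enorm_sub, ← he.supNorm_toGamma]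
      exact congrArg _ (map_sub (toGammaHom A) _ _).symm
  have h2 : ∀ k : pedersenIdeal A, Q.supUniform.comap (fun b => b * toGamma (k : A)) =
      UniformSpace.comap (fun b : Gamma A => (b.S k : A)) inferInstance := fun k =>
    comap_uniformOf Q.supNorm_zero Q.supNorm_neg Q.supNorm_add fun x y => by
      rw [he.mul_toGamma, he.mul_toGamma, edist_eq_enorm_sub, ← he.supNorm_toGamma]
      exact congrArg _ (map_sub (toGammaHom A) _ _).symm
  have h3 : Q.idealUniform (supportAlgebra fun n => toGamma (e n)) =
      ⨅ k : pedersenIdeal A, UniformSpace.comap (fun b : Gamma A => (b.T k : A)) inferInstance ⊓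
        UniformSpace.comap (fun b : Gamma A => (b.S k : A)) inferInstance := by
    rw [InvLimit.idealUniform, he.supportAlgebra_eq, iInf_image, iInf_subtype']
    exact iInf_congr fun k => by rw [← h1, ← h2]
  rw [h3, iInf_inf_eq, inf_comm]
  change _ = UniformSpace.comap gammaMaps (UniformSpace.comap Prod.fst (Pi.uniformSpace _) ⊓
    UniformSpace.comap Prod.snd (Pi.uniformSpace _))
  rw [UniformSpace.comap_inf, Pi.uniformSpace_eq]
  simp only [UniformSpace.comap_iInf, ← UniformSpace.comap_comap]
  rfl

theorem isClosed_range_gammaMaps :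
    IsClosed (Set.range (gammaMaps : Gamma A → (pedersenIdeal A → A) × (pedersenIdeal A → A))) := by
  have h : Set.range (gammaMaps : Gamma A → (pedersenIdeal A → A) × (pedersenIdeal A → A)) =
      ⋂ (x : pedersenIdeal A) (y : pedersenIdeal A), {p | (x : A) * p.1 y = p.2 x * (y : A)} := by
    ext p
    rw [Set.mem_iInter₂]
    constructor
    · rintro ⟨u, rfl⟩ x y
      exact u.central x y
    · intro h
      obtain ⟨u, h1, h2⟩ := he.exists_gamma_of_central h
      exact ⟨u, Prod.ext (funext h1) (funext h2)⟩
  rw [h]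
  exact isClosed_iInter fun x => isClosed_iInter fun y => isClosed_eq (by fun_prop) (by fun_prop)

/-- The algebra `Γ(K(A))` is locally compact by means of the canonical approximate identity. -/
theorem isLocallyCompactBy :
    he.invLimit.rangePresentation.IsLocallyCompactBy fun n => toGamma (e n) where
  nonneg n := isPos_toGamma (he.nonneg n)
  le_one n := isPos_one_sub_toGamma (he.nonneg n) (he.norm_le_one n)
  mulBounded n b := by
    change he.invLimit.rangePresentation.supNorm _ < ⊤
    rw [he.mul_toGamma b ⟨e n, he.mem_pedersenIdeal n⟩, he.supNorm_toGamma]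
    exact enorm_lt_top
  canonical n m h := by
    rw [← toGammaHom_apply, ← toGammaHom_apply, ← map_mul, he.canonical n m h]
  tendsto_one := by
    rw [he.idealUniform_eq, UniformSpace.toTopologicalSpace_comap, nhds_induced, tendsto_comap_iff]
    refine (Prod.tendsto_iff _ _).2 ⟨tendsto_pi_nhds.2 fun k => ?_, tendsto_pi_nhds.2 fun k => ?_⟩
    · exact he.tendsto_left (k : A)
    · exact he.tendsto_right (k : A)
  complete := by
    rw [he.idealUniform_eq]
    let _ : UniformSpace (Gamma A) := UniformSpace.comap gammaMaps inferInstance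
    have hind : IsUniformInducing
        (gammaMaps : Gamma A → (pedersenIdeal A → A) × (pedersenIdeal A → A)) := ⟨rfl⟩
    exact (completeSpace_iff_isComplete_range hind).2 he.isClosed_range_gammaMaps.isComplete
  norm_le n b := by
    set M := ⨆ (c : Gamma A) (_ : he.invLimit.rangePresentation.supNorm (toGamma (e n) * c) ≤ 1),
      he.invLimit.rangePresentation.supNorm (toGamma (e n) * c * b) with hMdef
    by_cases htop : M = ⊤
    · rw [htop]; exact le_top
    rw [norm_rangePresentation, ← ofReal_norm]
    refine ENNReal.ofReal_le_of_le_toReal ?_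
    refine HullMult.norm_le_of_T _ ENNReal.toReal_nonneg fun d => ?_
    rw [he.toHull_T]
    set x : pedersenIdeal A := ⟨star (e n) * d, _⟩ with hx
    change ‖(b.T x : A)‖ ≤ M.toReal * ‖(x : A)‖
    rcases eq_or_ne x 0 with h0 | h0
    · simp [h0]
    have hx0 : ‖(x : A)‖ ≠ 0 := by simpa using h0
    set r : ℂ := ((‖(x : A)‖⁻¹ : ℝ) : ℂ) with hr
    have hrn : ‖r‖ = ‖(x : A)‖⁻¹ := by simp [hr]
    -- `c = toGamma (r • d)` is normalized so that `‖eₙ c‖_∞ = 1`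
    have h1 : toGamma (e n) * toGamma (r • d) = toGamma ((r • x : pedersenIdeal A) : A) := by
      have h : e n * d = (x : A) := by rw [hx, Subtype.coe_mk, he.star_eq]
      rw [← toGammaHom_apply, ← toGammaHom_apply, ← map_mul, mul_smul_comm, h]
      rfl
    have h2 : ‖((r • x : pedersenIdeal A) : A)‖ = 1 := by
      rw [Submodule.coe_smul, norm_smul, hrn, inv_mul_cancel₀ hx0]
    have h3 : ‖(b.T (r • x) : A)‖ₑ ≤ M := by
      rw [← he.supNorm_toGamma, ← he.toGamma_mul, ← h1]
      refine le_iSup₂_of_le (toGamma (r • d)) ?_ le_rfl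
      rw [h1, he.supNorm_toGamma, ← ofReal_norm, h2, ENNReal.ofReal_one]
    have h4 : ‖(b.T (r • x) : A)‖ ≤ M.toReal := by
      rw [← toReal_enorm]; exact ENNReal.toReal_mono htop h3
    rw [map_smul, Submodule.coe_smul, norm_smul, hrn, inv_mul_le_iff₀ (by positivity)] at h4
    rwa [mul_comm]
  le_norm n b := by
    rw [he.toGamma_mul b ⟨e n, he.mem_pedersenIdeal n⟩, he.supNorm_toGamma, norm_rangePresentation,
      enorm_le_iff_norm_le]
    refine (HullMult.norm_T_le (he.toHull n b) ⟨e n, he.self_mem_rightHull n⟩).trans ?_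
    exact mul_le_of_le_one_right (norm_nonneg _) (he.norm_le_one n)

end IsCanonicalApproxId

end LCPro

theorem theorem2p2 {A₀ : Type u} [NonUnitalCStarAlgebra A₀] [PartialOrder A₀] [StarOrderedRing A₀]
    (hσ : LCPro.IsSigmaUnital A₀) :
    LCPro.IsLocallyCompact (LCPro.Gamma A₀) ∧
    (∃ e : ℕ → A₀, LCPro.IsCanonicalApproxId e ∧ ∀ n, e n ∈ LCPro.pedersenIdeal A₀) ∧
    ∀ e : ℕ → A₀, LCPro.IsCanonicalApproxId e → (∀ n, e n ∈ LCPro.pedersenIdeal A₀) →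
      -- the restriction maps make sense
      (∀ n, LCPro.leftHull (e n) ≤ LCPro.pedersenIdeal A₀ ∧
        LCPro.rightHull (star (e n)) ≤ LCPro.pedersenIdeal A₀ ∧
        LCPro.leftHull (e n) ≤ LCPro.leftHull (e (n + 1)) ∧
        LCPro.rightHull (star (e n)) ≤ LCPro.rightHull (star (e (n + 1)))) ∧
      -- `Γ(K(A₀))` is the inverse limit of the `M_{e_n}` along restriction maps
      (∃ P : LCPro.InvLimit (LCPro.Gamma A₀) (fun n => LCPro.HullMult (e n)),
        (∀ n u, LCPro.IsRestriction u (P.π n u)) ∧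
        (∀ n m, LCPro.IsRestriction m (P.conn n m)) ∧
        -- replacing `M_{e_n}` by the image of `Γ(K(A₀))` in it gives a presentation with
        -- surjective morphisms for which `(e_n)` satisfies all the requirements
        ∃ (X : ℕ → Type u) (_ : ∀ n, CStarAlgebra (X n))
          (Q : LCPro.InvLimit (LCPro.Gamma A₀) X)
          (ι : ∀ n, X n →⋆ₐ[ℂ] LCPro.HullMult (e n)),
          (∀ n, Function.Injective (ι n)) ∧ (∀ n u, ι n (Q.π n u) = P.π n u) ∧
          (∀ n, Function.Surjective (Q.π n)) ∧
          Q.IsLocallyCompactBy (fun n => LCPro.toGamma (e n))) ∧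
      -- the support algebra is the Pedersen ideal
      LCPro.supportAlgebra (fun n => LCPro.toGamma (e n)) =
        LCPro.toGamma '' (LCPro.pedersenIdeal A₀ : Set A₀) := by
  have hsurj : ∀ {e : ℕ → A₀} (he : LCPro.IsCanonicalApproxId e) (n : ℕ),
      Function.Surjective (he.invLimit.rangePresentation.π n) := by
    rintro e he n ⟨_, u, rfl⟩
    exact ⟨u, rfl⟩
  obtain ⟨d, hd⟩ := LCPro.exists_isCanonicalApproxId hσ
  refine ⟨⟨_, _, hd.invLimit.rangePresentation, hsurj hd, _, hd.isLocallyCompactBy⟩,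
    ⟨d, hd, hd.mem_pedersenIdeal⟩, fun e he _ => ⟨fun n => ⟨he.leftHull_le_pedersenIdeal n,
      he.rightHull_le_pedersenIdeal n, he.leftHull_mono n.le_succ, he.rightHull_mono n.le_succ⟩,
    ⟨he.invLimit, fun n u => he.isRestriction_toHull n u,
      fun n m => he.isRestriction_hullConn n m, _, _,
      he.invLimit.rangePresentation, fun n => (he.invLimit.π n).range.subtype,
      fun n => Subtype.val_injective, fun n u => rfl, hsurj he, he.isLocallyCompactBy⟩,
    he.supportAlgebra_eq⟩⟩
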